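/- Let $\Gamma$ be a finite group, $\Gamma_*$ its set of conjugacy classes, $c^0=\{1\}$ the identity class, and $\Gamma_n=\Gamma^n\rtimes S_n$ the wreath product with $(g,\sigma)(h,\tau)=(g\,\sigma(h),\sigma\tau)$, $\sigma(g_1,\dots,g_n)=(g_{\sigma^{-1}(1)},\dots,g_{\sigma^{-1}(n)})$. For a partition $\mu=(1^{m_1(\mu)}2^{m_2(\mu)}\cdots)$ let $\ell(\mu)$ be its number of parts and $\|\mu\|$ its size. Let $\mathcal P(\Gamma_*)$ be the set of partition-valued functions $\lambda=(\lambda(c))_{c\in\Gamma_*}$, put $\|\lambda\|=\sum_c\|\lambda(c)\|$, and define $\cup$ (union of parts), $\subset$ (containment of parts as multisets) and $-$ (removal of parts) pointwise; a partition $\mu$ is also regarded as the function with value $\mu$ at $c^0$ and $\emptyset$ elsewhere. For $r\ge 1$, $(r)_c$ is the function with value the one-part partition $(r)$ at $c$ and $\emptyset$ elsewhere. For $x=(g,\sigma)\in\Gamma_n$, a cycle $(i_1\,\dots\,i_k)$ of $\sigma$ (fixed points included) has cycle-product $g_{i_k}\cdots g_{i_1}$, which is well defined up to conjugacy. The type $\rho\in\mathcal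 P(\Gamma_*)$ of $x$ is given by letting the parts of $\rho(c)$ be the lengths of the cycles whose cycle-product lies in $c$. The modified type of $x$ is obtained from $\rho$ by lowering each part of $\rho(c^0)$ by $1$ (and dropping zeros). Let $K_\lambda(n)\in\mathbb Z[\Gamma_n]$ be the sum of all elements of $\Gamma_n$ of modified type $\lambda$. When $\|\nu\|=\|\lambda\|+\|\mu\|$, the coefficient of $K_\nu(n)$ in $K_\lambda(n)K_\mu(n)$ is the same integer $a_{\lambda\mu}^{\nu}$ for all $n$ with $K_\nu(n)\neq 0$. The Farahat–Higman ring $\mathcal G_\Gamma$ is the free abelian group with basis $(K_\lambda)_{\lambda\in\mathcal P(\Gamma_*)}$ and multiplication $$K_\lambda K_\mu=\sum_{\|\nu\|=\|\lambda\|+\|\mu\|}a_{\lambda\mu}^{\nu}K_\nu .$$ **Theorem.** Let $\lambda\in\mathcal P(\Gamma_*)$, $r\ge 1$ and $c\in\Gamma_*\setminus\{c^0\}$. Then the structure constants $a_{\lambda\,(r)_c}^{\nu}$, $\|\nu\|=\|\lambda\|+r$, are well defined (independent of $n$), and in $\mathcal G_\Gamma$ $$K_\lambda K_{(r)_c}=\sum_{\mu}\frac{\bigl(m_{\|\mu\|+r}(\lambda(c))+1\bigr)\,(\|\mu\|+r)\,(r-1)!}{(r-\ell(\mu))!\,\prod_{i\ge1}m_i(\mu)!}\;K_{\lambda\cup(\|\mu\|+r)_c-\mu},$$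 where the sum is over all partitions $\mu\subset\lambda(c^0)$ (including $\emptyset$) with $\ell(\mu)\le r$, and all the coefficients displayed are integers. -/

import Mathlib

open scoped Nat

namespace FarahatHigman

/-- The wreath product `Γ_n = Γ^n ⋊ S_n`, where `σ (g_1, …, g_n) = (g_{σ⁻¹ 1}, …, g_{σ⁻¹ n})` and
`(g, σ) (h, τ) = (g σ(h), σ τ)`. -/
abbrev Wreath (Γ : Type*) [Group Γ] (n : ℕ) : Type _ :=
  (Fin n → Γ) ⋊[mulAutArrow] Equiv.Perm (Fin n)

instance (Γ : Type*) [Group Γ] [Finite Γ] (n : ℕ) : Finite (Wreath Γ n) :=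
  Finite.of_equiv _ SemidirectProduct.equivProd.symm

section Partitions

/-- A partition, as the finite multiset of its (positive) parts. Thus `λ ∪ μ` is `λ + μ`,
`μ ⊂ λ` is `μ ≤ λ`, the partition `λ - μ` is the difference of multisets, `ℓ(λ)` is
`Multiset.card λ` and `m_i(λ)` is `Multiset.count i λ`. -/
abbrev Partn : Type := Multiset ℕ+

/-- The size `|μ|`, the sum of the parts. -/
def Partn.size (μ : Partn) : ℕ := (μ.map (fun i : ℕ+ => (i : ℕ))).sum

/-- Partition-valued functions on the set `Γ_*` of conjugacy classes of `Γ`; the operations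
`∪` (i.e. `+`), `-` and the relation `⊂` (i.e. `≤`) are pointwise. -/
abbrev PartnFun (Γ : Type*) [Group Γ] : Type _ := ConjClasses Γ → Partn

variable {Γ : Type*} [Group Γ]

/-- The degree `‖ρ‖ = ∑_c |ρ(c)|` (a finite sum when `Γ` is finite). -/
noncomputable def PartnFun.deg (ρ : PartnFun Γ) : ℕ := ∑ᶠ c : ConjClasses Γ, Partn.size (ρ c)

open Classical in
/-- The partition-valued function which is `μ` at `c` and empty elsewhere. -/
noncomputable def PartnFun.at (c : ConjClasses Γ) (μ : Partn) : PartnFun Γ := Pi.single c μ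

/-- `(r)_c`, the partition-valued function with a single part `r ≥ 1`, at the class `c`. -/
noncomputable def PartnFun.cycle (r : ℕ+) (c : ConjClasses Γ) : PartnFun Γ := PartnFun.at c {r}

/-- The positive integer `‖μ‖ + r`. -/
def addSize (μ : Partn) (r : ℕ+) : ℕ+ := ⟨μ.size + r, Nat.add_pos_right _ r.pos⟩

theorem Partn.mem_le_size {μ : Partn} {i : ℕ+} (h : i ∈ μ) : (i : ℕ) ≤ μ.size :=
  Multiset.single_le_sum (fun _ _ => Nat.zero_le _) _ (Multiset.mem_map_of_mem _ h)

theorem Partn.card_le_size (μ : Partn) : Multiset.card μ ≤ μ.size := by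
  have h := Multiset.card_nsmul_le_sum (s := μ.map (fun i : ℕ+ => (i : ℕ))) (a := 1) (by
    intro x hx
    obtain ⟨i, _, rfl⟩ := Multiset.mem_map.1 hx
    exact i.pos)
  simpa [Partn.size] using h

/-- There are finitely many partitions of size at most `d`. -/
theorem Partn.finite_size_le (d : ℕ) : {μ : Partn | μ.size ≤ d}.Finite := by
  refine (Set.finite_Iic (d • (Finset.Icc (1 : ℕ+) (Nat.succPNat d)).val : Multiset ℕ+)).subset ?_
  intro μ hμ
  rw [Set.mem_Iic, Multiset.le_iff_count]
  intro i
  rw [Multiset.count_nsmul]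
  by_cases hi : i ∈ μ
  · have h1 : (i : ℕ) ≤ d := (Partn.mem_le_size hi).trans hμ
    have h2 : i ∈ (Finset.Icc (1 : ℕ+) (Nat.succPNat d)).val := by
      rw [Finset.mem_val, Finset.mem_Icc]
      refine ⟨one_le, ?_⟩
      rw [← PNat.coe_le_coe, Nat.succPNat_coe]
      omega
    calc μ.count i ≤ Multiset.card μ := Multiset.count_le_card _ _
      _ ≤ d := (Partn.card_le_size μ).trans hμ
      _ = d * 1 := (mul_one d).symm
      _ ≤ _ := Nat.mul_le_mul_left d (Multiset.one_le_count_iff_mem.2 h2)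
  · rw [Multiset.count_eq_zero_of_notMem hi]
    exact Nat.zero_le _

/-- There are finitely many partition-valued functions of a given degree. -/
theorem PartnFun.finite_deg_eq [Finite Γ] (d : ℕ) : {ρ : PartnFun Γ | ρ.deg = d}.Finite := by
  refine (Set.Finite.pi' (fun _ : ConjClasses Γ => Partn.finite_size_le d)).subset ?_
  intro ρ hρ c
  have hρ' : ∑ᶠ c : ConjClasses Γ, Partn.size (ρ c) = d := hρ
  change Partn.size (ρ c) ≤ d
  rw [← hρ']
  exact single_le_finsum (f := fun c => Partn.size (ρ c)) c (Set.toFinite _)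
    (fun _ => Nat.zero_le _)

end Partitions

section ModifiedType

variable {Γ : Type*} [Group Γ] {n : ℕ}

/-- The length of the cycle of `σ` through `i`. -/
noncomputable def cycleLen (σ : Equiv.Perm (Fin n)) (i : Fin n) : ℕ := Function.minimalPeriod σ i

/-- For `x = (g, σ)` and the cycle `(i_1 i_2 … i_k)` of `σ` written so that `i_k = i`, the
cycle-product `g_{i_k} g_{i_{k-1}} ⋯ g_{i_1}`; note that `i_{k-j} = σ^{-j} i`. -/
noncomputable def cycleProd (x : Wreath Γ n) (i : Fin n) : Γ :=
  ((List.range (cycleLen x.right i)).map (fun j => x.left ((x.right ^ j)⁻¹ i))).prod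

theorem cycleLen_pos (σ : Equiv.Perm (Fin n)) (i : Fin n) : 0 < cycleLen σ i :=
  Function.minimalPeriod_pos_of_mem_periodicPts
    (Function.Injective.mem_periodicPts σ.injective i)

theorem cycleLen_apply (σ : Equiv.Perm (Fin n)) (i : Fin n) : cycleLen σ (σ i) = cycleLen σ i :=
  Function.minimalPeriod_apply (Function.Injective.mem_periodicPts σ.injective i)

theorem pow_cycleLen (σ : Equiv.Perm (Fin n)) (i : Fin n) : (σ ^ cycleLen σ i) i = i := by
  have h := Function.isPeriodicPt_minimalPeriod σ i
  rw [Function.IsPeriodicPt, Function.IsFixedPt, Equiv.Perm.iterate_eq_pow] at h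
  exact h

theorem cycleProd_apply (x : Wreath Γ n) (i : Fin n) :
    cycleProd x (x.right i) = x.left (x.right i) * cycleProd x i * (x.left (x.right i))⁻¹ := by
  obtain ⟨k, hk⟩ := Nat.exists_eq_succ_of_ne_zero (cycleLen_pos x.right i).ne'
  have hpow := pow_cycleLen x.right i
  have hlast : (x.right ^ k)⁻¹ i = x.right i := by
    rw [Equiv.Perm.inv_eq_iff_eq, ← Equiv.Perm.mul_apply, ← pow_succ, ← Nat.succ_eq_add_one,
      ← hk, hpow]
  have hshift : ∀ j : ℕ, (x.right ^ (j + 1))⁻¹ (x.right i) = (x.right ^ j)⁻¹ i := by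
    intro j
    rw [Equiv.Perm.inv_eq_iff_eq, pow_succ', Equiv.Perm.mul_apply, ← Equiv.Perm.mul_apply (x.right ^ j),
      mul_inv_cancel, Equiv.Perm.one_apply]
  unfold cycleProd
  rw [cycleLen_apply, hk, Nat.succ_eq_add_one]
  conv_lhs => rw [List.prod_range_succ']
  conv_rhs => rw [List.prod_range_succ, hlast]
  simp only [hshift, pow_zero, inv_one, Equiv.Perm.one_apply]
  group

/-- The cycles of `x` (fixed points included): the orbits of its permutation. -/
abbrev Cycles (x : Wreath Γ n) : Type := Quotient (Equiv.Perm.SameCycle.setoid x.right)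

theorem eq_of_sameCycle {α : Type*} {σ : Equiv.Perm (Fin n)} (f : Fin n → α)
    (hf : ∀ i, f (σ i) = f i) {i j : Fin n} (h : σ.SameCycle i j) : f i = f j := by
  obtain ⟨k, -, rfl⟩ := h.exists_nat_pow_eq
  clear h
  induction k with
  | zero => rfl
  | succ k ih => rw [pow_succ', Equiv.Perm.mul_apply, hf, ← ih]

/-- The length of a cycle. -/
noncomputable def Cycles.len (x : Wreath Γ n) : Cycles x → ℕ+ :=
  Quotient.lift (fun i => (⟨cycleLen x.right i, cycleLen_pos x.right i⟩ : ℕ+)) (by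
    intro i j h
    exact eq_of_sameCycle
      (fun i => (⟨cycleLen x.right i, cycleLen_pos x.right i⟩ : ℕ+))
      (fun i => Subtype.ext (cycleLen_apply x.right i)) h)

/-- The conjugacy class of the cycle-product of a cycle. -/
noncomputable def Cycles.cls (x : Wreath Γ n) : Cycles x → ConjClasses Γ :=
  Quotient.lift (fun i => ConjClasses.mk (cycleProd x i)) (by
    intro i j h
    refine eq_of_sameCycle (fun i => ConjClasses.mk (cycleProd x i)) (fun i => ?_) h
    rw [cycleProd_apply]
    exact (ConjClasses.mk_eq_mk_iff_isConj.2 (isConj_iff.2 ⟨_, rfl⟩)).symm)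

open Classical in
/-- The type `ρ` of `x`: the parts of `ρ(c)` are the lengths of the cycles of `x` whose
cycle-product lies in `c`. -/
noncomputable def wreathType (x : Wreath Γ n) : PartnFun Γ := fun c =>
  ((Finset.univ : Finset (Cycles x)).filter (fun q => Cycles.cls x q = c)).val.map (Cycles.len x)

/-- The partition `(ρ_1 - 1, …, ρ_r - 1)` obtained from `(ρ_1, …, ρ_r)` (zeros dropped). -/
def Partn.pred (ρ : Partn) : Partn :=
  ρ.filterMap (fun i : ℕ+ => if 1 < i then some (i - 1) else none)

open Classical in
/-- The modified type of `x`: every part of the partition at the identity class is lowered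
by one. -/
noncomputable def modType (x : Wreath Γ n) : PartnFun Γ := fun c =>
  if c = 1 then (wreathType x c).pred else wreathType x c

end ModifiedType

section Ring

variable {Γ : Type*} [Group Γ]

/-- The underlying group of the Farahat-Higman ring `𝒢_Γ`: the free abelian group on the
partition-valued functions on the set of conjugacy classes of `Γ`. -/
def FHRing (Γ : Type*) [Group Γ] : Type _ := PartnFun Γ →₀ ℤ

noncomputable instance (Γ : Type*) [Group Γ] : AddCommGroup (FHRing Γ) :=
  inferInstanceAs (AddCommGroup (PartnFun Γ →₀ ℤ))

/-- The basis element `K_lam` of the Farahat-Higman ring. -/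
noncomputable def K (lam : PartnFun Γ) : FHRing Γ := (Finsupp.single lam 1 : PartnFun Γ →₀ ℤ)

/-- The homomorphism of additive groups with prescribed values on the basis. -/
noncomputable def extend {A : Type*} [AddCommGroup A] (f : PartnFun Γ → A) : FHRing Γ →+ A :=
  (Finsupp.liftAddHom (fun lam => zmultiplesHom A (f lam)) : (PartnFun Γ →₀ ℤ) →+ A)

theorem extend_K {A : Type*} [AddCommGroup A] (f : PartnFun Γ → A) (lam : PartnFun Γ) :
    extend f (K lam) = f lam := by
  have h : (Finsupp.liftAddHom (fun lam => zmultiplesHom A (f lam)) : (PartnFun Γ →₀ ℤ) →+ A)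
      (Finsupp.single lam 1) = f lam := by
    simp
  exact h

variable [Finite Γ]

/-- `K_lam(n)`: the sum in the group ring `ℤ[Γ_n]` of all elements of `Γ_n` of modified
type `lam`. -/
noncomputable def classSum (n : ℕ) (lam : PartnFun Γ) : MonoidAlgebra ℤ (Wreath Γ n) :=
  ∑ x ∈ (Set.toFinite {x : Wreath Γ n | modType x = lam}).toFinset, MonoidAlgebra.single x 1

/-- For every `n`, the coefficient of `K_ν(n)` in `K_lam(n) K_mu(n)`, that is, the value of
the convolution product at each element of `Γ_n` of modified type `ν`, equals `a`. (There is a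
condition only for those `n` with `K_ν(n) ≠ 0`, which all large `n` satisfy, so `a` is unique.) -/
def IsStructConst (lam mu ν : PartnFun Γ) (a : ℤ) : Prop :=
  ∀ (n : ℕ) (z : Wreath Γ n), modType z = ν → (classSum n lam * classSum n mu).coeff z = a

open Classical in
/-- The structure constant `a_{lam mu}^ν`: the common value, for all `n`, of the coefficients of
`K_ν(n)` in `K_lam(n) K_mu(n)`. It is used only for `‖ν‖ = ‖lam‖ + ‖mu‖`. -/
noncomputable def structConst (lam mu ν : PartnFun Γ) : ℤ :=
  if h : ∃ a, IsStructConst lam mu ν a then h.choose else 0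

/-- The product of two basis elements:
`K_lam K_mu = ∑_{‖ν‖ = ‖lam‖ + ‖mu‖} a_{lam mu}^ν K_ν`. -/
noncomputable def basisMul (lam mu : PartnFun Γ) : FHRing Γ :=
  ∑ ν ∈ (PartnFun.finite_deg_eq (Γ := Γ) (lam.deg + mu.deg)).toFinset,
    structConst lam mu ν • K ν

/-- The biadditive extension of `basisMul`. -/
noncomputable def mulHom : FHRing Γ →+ FHRing Γ →+ FHRing Γ :=
  extend (fun lam => extend (fun mu => basisMul lam mu))

noncomputable instance : NonUnitalNonAssocRing (FHRing Γ) where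
  mul f g := mulHom f g
  left_distrib f g h := map_add (mulHom f) g h
  right_distrib f g h := by
    change mulHom (f + g) h = mulHom f h + mulHom g h
    rw [map_add, AddMonoidHom.add_apply]
  zero_mul f := by
    change mulHom 0 f = 0
    rw [map_zero, AddMonoidHom.zero_apply]
  mul_zero f := map_zero (mulHom f)

theorem K_mul_K (lam mu : PartnFun Γ) : K lam * K mu = basisMul lam mu := by
  change mulHom (K lam) (K mu) = _
  rw [mulHom, extend_K, extend_K]

end Ring

/-- The numerator `(m_{‖μ‖ + r}(lam(c)) + 1) (‖μ‖ + r) (r - 1)!`. -/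
noncomputable def coeffNum {Γ : Type*} [Group Γ] (lam : PartnFun Γ) (r : ℕ+)
    (c : ConjClasses Γ) (μ : Partn) : ℕ :=
  ((lam c).count (addSize μ r) + 1) * (μ.size + r) * ((r : ℕ) - 1)!

/-- The denominator `(r - ℓ(μ))! ∏_{i ≥ 1} m_i(μ)!`, for `ℓ(μ) ≤ r`. -/
def coeffDen (r : ℕ+) (μ : Partn) : ℕ :=
  ((r : ℕ) - Multiset.card μ)! * ∏ i ∈ μ.toFinset, (μ.count i)!

end FarahatHigman

open scoped Nat

namespace FarahatHigman

section Labels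

variable {Γ : Type*} [Group Γ] {n : ℕ}

/-- The label picked up by `x` at `i`: `x` acts on `Γ × Fin n` by `(a, i) ↦ (lab x i * a, x i)`. -/
def lab (x : Wreath Γ n) (i : Fin n) : Γ := x.left (x.right i)

theorem lab_mul (x y : Wreath Γ n) (i : Fin n) :
    lab (x * y) i = lab x (y.right i) * lab y i := by
  change x.left (x.right (y.right i)) * y.left (x.right⁻¹ (x.right (y.right i))) = _
  rw [show x.right⁻¹ (x.right (y.right i)) = y.right i from Equiv.symm_apply_apply _ _]
  rfl

theorem wreath_ext {x y : Wreath Γ n} (h : ∀ i, x.right i = y.right i)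
    (h' : ∀ i, lab x i = lab y i) : x = y := by
  have hr : x.right = y.right := Equiv.ext h
  refine SemidirectProduct.ext ?_ hr
  funext j
  have := h' (x.right⁻¹ j)
  unfold lab at this
  rw [← hr] at this
  simpa using this

/-- The element of the wreath product with a given permutation and given labels. -/
def ofLab (σ : Equiv.Perm (Fin n)) (f : Fin n → Γ) : Wreath Γ n := ⟨fun j => f (σ⁻¹ j), σ⟩

theorem lab_ofLab (σ : Equiv.Perm (Fin n)) (f : Fin n → Γ) (i : Fin n) :
    lab (ofLab σ f) i = f i := by
  change f (σ⁻¹ (σ i)) = f i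
  rw [← Equiv.Perm.mul_apply, inv_mul_cancel, Equiv.Perm.one_apply]

theorem right_pow (x : Wreath Γ n) (k : ℕ) : (x ^ k).right = x.right ^ k :=
  map_pow SemidirectProduct.rightHom x k

theorem pow_left (x : Wreath Γ n) (k : ℕ) (i : Fin n) :
    (x ^ k).left i = ((List.range k).map (fun j => x.left ((x.right ^ j)⁻¹ i))).prod := by
  induction k with
  | zero => rfl
  | succ k ih =>
    rw [List.prod_range_succ, ← ih, pow_succ]
    change (x ^ k).left i * x.left ((x ^ k).right⁻¹ i) = _
    rw [right_pow]

theorem cycleProd_eq_lab (x : Wreath Γ n) (i : Fin n) :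
    cycleProd x i = lab (x ^ cycleLen x.right i) i := by
  unfold cycleProd lab
  rw [← pow_left, right_pow, pow_cycleLen]

/-- The conjugacy class of the cycle-product of the cycle through `i`. -/
noncomputable def clsAt (x : Wreath Γ n) (i : Fin n) : ConjClasses Γ :=
  ConjClasses.mk (cycleProd x i)

theorem mk_eq_one_iff (a : Γ) : ConjClasses.mk a = 1 ↔ a = 1 := by
  rw [ConjClasses.one_eq_mk_one, ConjClasses.mk_eq_mk_iff_isConj, isConj_comm, isConj_one_right]

theorem clsAt_eq_one_iff (x : Wreath Γ n) (i : Fin n) : clsAt x i = 1 ↔ cycleProd x i = 1 :=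
  mk_eq_one_iff _

theorem clsAt_apply (x : Wreath Γ n) (i : Fin n) : clsAt x (x.right i) = clsAt x i := by
  unfold clsAt
  rw [cycleProd_apply]
  exact (ConjClasses.mk_eq_mk_iff_isConj.2 (isConj_iff.2 ⟨_, rfl⟩)).symm

theorem cycleLen_congr {σ : Equiv.Perm (Fin n)} {i j : Fin n} (h : σ.SameCycle i j) :
    cycleLen σ i = cycleLen σ j := eq_of_sameCycle _ (cycleLen_apply σ) h

theorem clsAt_congr {x : Wreath Γ n} {i j : Fin n} (h : x.right.SameCycle i j) :
    clsAt x i = clsAt x j := eq_of_sameCycle _ (clsAt_apply x) h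

theorem sameCycle_pow (σ : Equiv.Perm (Fin n)) (m : ℕ) (i : Fin n) :
    σ.SameCycle i ((σ ^ m) i) := ⟨m, by simp⟩

theorem cycleLen_eq_of {σ : Equiv.Perm (Fin n)} {i : Fin n} {k : ℕ} (hk : 0 < k)
    (h : (σ ^ k) i = i) (h' : ∀ m, 0 < m → m < k → (σ ^ m) i ≠ i) : cycleLen σ i = k := by
  refine le_antisymm ?_ ?_
  · refine Function.IsPeriodicPt.minimalPeriod_le hk ?_
    rw [Function.IsPeriodicPt, Function.IsFixedPt, Equiv.Perm.iterate_eq_pow, h]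
  · by_contra hlt
    exact h' _ (cycleLen_pos σ i) (not_le.1 hlt) (pow_cycleLen σ i)

theorem pow_ne_of_lt_cycleLen {σ : Equiv.Perm (Fin n)} {i : Fin n} {m : ℕ} (hm : 0 < m)
    (h : m < cycleLen σ i) : (σ ^ m) i ≠ i := by
  intro h'
  have : Function.IsPeriodicPt σ m i := by
    rw [Function.IsPeriodicPt, Function.IsFixedPt, Equiv.Perm.iterate_eq_pow, h']
  exact absurd (this.minimalPeriod_le hm) (not_le.2 h)

theorem pow_injOn_cycleLen {σ : Equiv.Perm (Fin n)} {i : Fin n} {a b : ℕ}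
    (ha : a < cycleLen σ i) (hb : b < cycleLen σ i) (h : (σ ^ a) i = (σ ^ b) i) : a = b := by
  wlog hab : a ≤ b generalizing a b
  · exact (this hb ha h.symm (le_of_not_ge hab)).symm
  obtain ⟨d, rfl⟩ := Nat.exists_eq_add_of_le hab
  rw [pow_add, Equiv.Perm.mul_apply, (σ ^ a).apply_eq_iff_eq] at h
  by_contra hne
  exact pow_ne_of_lt_cycleLen (i := i) (σ := σ) (m := d) (by omega) (by omega) h.symm

theorem exists_pow_lt_of_sameCycle {σ : Equiv.Perm (Fin n)} {i j : Fin n} (h : σ.SameCycle i j) :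
    ∃ m < cycleLen σ i, (σ ^ m) i = j := by
  obtain ⟨k, rfl⟩ := h.exists_nat_pow_eq
  refine ⟨k % cycleLen σ i, Nat.mod_lt _ (cycleLen_pos σ i), ?_⟩
  have h := Function.iterate_mod_minimalPeriod_eq (f := σ) (x := i) (n := k)
  rwa [Equiv.Perm.iterate_eq_pow, Equiv.Perm.iterate_eq_pow] at h

open Classical in
theorem filter_sameCycle_eq_image (σ : Equiv.Perm (Fin n)) (i : Fin n) :
    Finset.univ.filter (fun j => σ.SameCycle i j) =
      (Finset.range (cycleLen σ i)).image (fun m => (σ ^ m) i) := by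
  ext j
  simp only [Finset.mem_filter, Finset.mem_univ, true_and, Finset.mem_image, Finset.mem_range]
  refine ⟨exists_pow_lt_of_sameCycle, ?_⟩
  rintro ⟨m, -, rfl⟩
  exact sameCycle_pow σ m i

open Classical in
theorem card_filter_sameCycle (σ : Equiv.Perm (Fin n)) (i : Fin n) :
    (Finset.univ.filter (fun j => σ.SameCycle i j)).card = cycleLen σ i := by
  rw [filter_sameCycle_eq_image, Finset.card_image_of_injOn, Finset.card_range]
  intro a ha b hb h
  exact pow_injOn_cycleLen (by simpa using ha) (by simpa using hb) h

open Classical in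
/-- Sums over points in terms of sums over cycles. -/
theorem sum_points {M : Type*} [AddCommMonoid M] (x : Wreath Γ n) (F : ℕ → ConjClasses Γ → M) :
    ∑ i, F (cycleLen x.right i) (clsAt x i) =
      ∑ q : Cycles x, (Cycles.len x q : ℕ) • F (Cycles.len x q) (Cycles.cls x q) := by
  rw [← Finset.sum_fiberwise (s := Finset.univ) (g := fun i => (Quotient.mk _ i : Cycles x))]
  refine Finset.sum_congr rfl fun q _ => ?_
  induction q using Quotient.inductionOn with
  | _ j =>
  have h : Finset.univ.filter
      (fun i => (Quotient.mk (Equiv.Perm.SameCycle.setoid x.right) i) = Quotient.mk _ j) =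
      Finset.univ.filter (fun i => x.right.SameCycle j i) := by
    ext i
    simp only [Finset.mem_filter, Finset.mem_univ, true_and]
    rw [Quotient.eq]
    exact ⟨fun h => Equiv.Perm.SameCycle.symm h, fun h => Equiv.Perm.SameCycle.symm h⟩
  rw [h]
  rw [Finset.sum_congr rfl (g := fun _ => F (cycleLen x.right j) (clsAt x j))]
  · rw [Finset.sum_const, card_filter_sameCycle]
    rfl
  · intro i hi
    have hi' : x.right.SameCycle j i := by simpa using hi
    rw [cycleLen_congr hi', clsAt_congr hi']

open Classical in
theorem sum_map_wreathType {M : Type*} [AddCommMonoid M] (x : Wreath Γ n) (c : ConjClasses Γ)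
    (G : ℕ+ → M) : ((wreathType x c).map G).sum =
      ∑ q : Cycles x, if Cycles.cls x q = c then G (Cycles.len x q) else 0 := by
  unfold wreathType
  rw [Multiset.map_map, ← Finset.sum_filter]
  rfl

open Classical in
theorem sum_points_of_cls {M : Type*} [AddCommMonoid M] (x : Wreath Γ n) (c : ConjClasses Γ)
    (G : ℕ → M) : ∑ i, (if clsAt x i = c then G (cycleLen x.right i) else 0) =
      ((wreathType x c).map (fun k : ℕ+ => (k : ℕ) • G k)).sum := by
  rw [sum_map_wreathType, sum_points x (fun k d => if d = c then G k else 0)]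
  refine Finset.sum_congr rfl fun q _ => ?_
  split_ifs <;> simp

open Classical in
theorem card_points (x : Wreath Γ n) (c : ConjClasses Γ) (k : ℕ+) :
    (Finset.univ.filter (fun i => clsAt x i = c ∧ cycleLen x.right i = k)).card =
      k * (wreathType x c).count k := by
  have h := sum_points_of_cls x c (fun l => if l = k then 1 else 0)
  rw [Finset.card_filter]
  simp only [ite_and, h]
  generalize wreathType x c = W
  induction W using Multiset.induction_on with
  | empty => simp
  | cons a W ih =>
    rw [Multiset.map_cons, Multiset.sum_cons, ih, Multiset.count_cons]
    by_cases h : (a : ℕ) = k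
    · have : a = k := PNat.coe_inj.1 h
      subst this
      simp
      ring
    · have : k ≠ a := fun h' => h (by rw [h'])
      simp [h, this]

open Classical in
theorem card_wreathType_one (x : Wreath Γ n) :
    ∑ i, (if clsAt x i = 1 then (cycleLen x.right i : ℚ)⁻¹ else 0) =
      Multiset.card (wreathType x 1) := by
  rw [sum_points_of_cls x 1 (fun k => (k : ℚ)⁻¹)]
  generalize wreathType x 1 = W
  induction W using Multiset.induction_on with
  | empty => simp
  | cons a W ih =>
    rw [Multiset.map_cons, Multiset.sum_cons, ih, Multiset.card_cons]
    simp
    ring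

end Labels

section Degree

theorem Partn.size_add (μ ν : Partn) : Partn.size (μ + ν) = μ.size + ν.size := by
  simp [Partn.size]

theorem Partn.size_cons (a : ℕ+) (ν : Partn) : Partn.size (a ::ₘ ν) = a + ν.size := by
  simp [Partn.size]

theorem Partn.pred_add (μ ν : Partn) : Partn.pred (μ + ν) = μ.pred + ν.pred :=
  Multiset.filterMap_add _ _ _

theorem Partn.pred_cons (a : ℕ+) (μ : Partn) :
    Partn.pred (a ::ₘ μ) = (if 1 < a then {a - 1} else 0) + μ.pred := by
  unfold Partn.pred
  rw [Multiset.filterMap_cons]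
  split_ifs <;> rfl

theorem Partn.size_pred_add_card (μ : Partn) : μ.pred.size + Multiset.card μ = μ.size := by
  induction μ using Multiset.induction_on with
  | empty => rfl
  | cons a W ih =>
    rw [pred_cons, size_add, size_cons, ← ih, Multiset.card_cons]
    split_ifs with h
    · have h1 : ((a - 1 : ℕ+) : ℕ) = (a : ℕ) - 1 := by rw [PNat.sub_coe, if_pos h]; rfl
      have := a.pos
      have h2 : Partn.size {a - 1} = (a : ℕ) - 1 := by simp [Partn.size, h1]
      rw [h2]; omega
    · have : a = 1 := le_antisymm (not_lt.1 h) one_le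
      subst this
      simp [Partn.size]
      ring

theorem Partn.card_pred_le (μ : Partn) : Multiset.card μ.pred ≤ Multiset.card μ := by
  induction μ using Multiset.induction_on with
  | empty => rfl
  | cons a W ih =>
    rw [pred_cons, Multiset.card_cons, Multiset.card_add]
    split_ifs <;> simp <;> omega

variable {Γ : Type*} [Group Γ] {n : ℕ}

theorem PartnFun.deg_eq_sum [Fintype (ConjClasses Γ)] (ρ : PartnFun Γ) :
    ρ.deg = ∑ c, Partn.size (ρ c) := finsum_eq_sum_of_fintype _

theorem modType_one (x : Wreath Γ n) : modType x 1 = (wreathType x 1).pred := if_pos rfl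

theorem modType_of_ne (x : Wreath Γ n) {c : ConjClasses Γ} (hc : c ≠ 1) :
    modType x c = wreathType x c := if_neg hc

variable [Finite Γ]

theorem PartnFun.deg_add (ρ τ : PartnFun Γ) : (ρ + τ).deg = ρ.deg + τ.deg := by
  have := Fintype.ofFinite (ConjClasses Γ)
  simp [deg_eq_sum, Partn.size_add, Finset.sum_add_distrib]

theorem PartnFun.deg_at (c : ConjClasses Γ) (μ : Partn) : (PartnFun.at c μ).deg = μ.size := by
  classical
  have := Fintype.ofFinite (ConjClasses Γ)
  rw [deg_eq_sum, Finset.sum_eq_single c]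
  · simp [PartnFun.at]
  · intro b _ hb
    simp [PartnFun.at, hb, Partn.size]
  · simp

theorem PartnFun.deg_cycle (c : ConjClasses Γ) (r : ℕ+) : (PartnFun.cycle r c).deg = r := by
  rw [cycle, deg_at]
  simp [Partn.size]

theorem deg_wreathType (x : Wreath Γ n) : PartnFun.deg (wreathType x) = n := by
  classical
  have := Fintype.ofFinite (ConjClasses Γ)
  have h := sum_points x (fun _ _ => 1)
  simp only [Finset.sum_const, Finset.card_univ, Fintype.card_fin, smul_eq_mul, mul_one] at h
  refine Eq.trans ?_ h.symm
  rw [PartnFun.deg_eq_sum]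
  simp only [Partn.size, sum_map_wreathType]
  rw [Finset.sum_comm]
  refine Finset.sum_congr rfl fun q _ => ?_
  simp

theorem deg_modType_add_card (x : Wreath Γ n) :
    (modType x).deg + Multiset.card (wreathType x 1) = n := by
  classical
  have := Fintype.ofFinite (ConjClasses Γ)
  conv_rhs => rw [← deg_wreathType x]
  rw [PartnFun.deg_eq_sum, PartnFun.deg_eq_sum, ← Finset.add_sum_erase _ _ (Finset.mem_univ 1),
    ← Finset.add_sum_erase _ (fun c => Partn.size (wreathType x c)) (Finset.mem_univ 1),
    modType_one, ← Partn.size_pred_add_card (wreathType x 1), add_right_comm]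
  congr 1
  refine Finset.sum_congr rfl fun c hc => ?_
  rw [modType_of_ne x (Finset.ne_of_mem_erase hc)]

end Degree

section Agree

variable {Γ : Type*} [Group Γ] {n : ℕ} {T : Finset (Fin n)} {x y z : Wreath Γ n}

theorem lab_pow_add (x : Wreath Γ n) (a b : ℕ) (i : Fin n) :
    lab (x ^ (a + b)) i = lab (x ^ a) ((x.right ^ b) i) * lab (x ^ b) i := by
  rw [pow_add, lab_mul, right_pow]

theorem lab_pow_succ (x : Wreath Γ n) (a : ℕ) (i : Fin n) :
    lab (x ^ (a + 1)) i = lab (x ^ a) (x.right i) * lab x i := by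
  rw [lab_pow_add, pow_one, pow_one]

theorem perm_pow_succ_apply (σ : Equiv.Perm (Fin n)) (a : ℕ) (i : Fin n) :
    (σ ^ (a + 1)) i = (σ ^ a) (σ i) := by
  rw [pow_succ, Equiv.Perm.mul_apply]

/-- `y` acts trivially off `T`. -/
def TrivOff (T : Finset (Fin n)) (y : Wreath Γ n) : Prop :=
  ∀ i ∉ T, y.right i = i ∧ lab y i = 1

/-- `x` and `z` act in the same way off `T`. -/
def AgreeOff (T : Finset (Fin n)) (x z : Wreath Γ n) : Prop :=
  ∀ i ∉ T, x.right i = z.right i ∧ lab x i = lab z i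

theorem AgreeOff.symm (h : AgreeOff T x z) : AgreeOff T z x :=
  fun i hi => ⟨(h i hi).1.symm, (h i hi).2.symm⟩

theorem TrivOff.agreeOff (h : TrivOff T y) (x : Wreath Γ n) : AgreeOff T x (x * y) := by
  intro i hi
  rw [lab_mul, SemidirectProduct.mul_right, Equiv.Perm.mul_apply, (h i hi).1, (h i hi).2, mul_one]
  exact ⟨rfl, rfl⟩

theorem AgreeOff.pow (h : AgreeOff T x z) {i : Fin n} {M : ℕ}
    (hM : ∀ m < M, (z.right ^ m) i ∉ T) :
    (x.right ^ M) i = (z.right ^ M) i ∧ lab (x ^ M) i = lab (z ^ M) i := by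
  induction M with
  | zero => exact ⟨rfl, rfl⟩
  | succ M ih =>
    obtain ⟨h1, h2⟩ := ih fun m hm => hM m (by omega)
    obtain ⟨h3, h4⟩ := h _ (hM M (by omega))
    constructor
    · rw [pow_succ', pow_succ', Equiv.Perm.mul_apply, Equiv.Perm.mul_apply, h1, h3]
    · rw [pow_succ', pow_succ', lab_mul, lab_mul, right_pow, right_pow, h1, h2, h4]

/-- The cycle of `x` through `i` meets `T`. -/
def Meets (T : Finset (Fin n)) (x : Wreath Γ n) (i : Fin n) : Prop :=
  ∃ m : ℕ, (x.right ^ m) i ∈ T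

theorem AgreeOff.meets_iff (h : AgreeOff T x z) (i : Fin n) : Meets T x i ↔ Meets T z i := by
  have key : ∀ {u v : Wreath Γ n}, AgreeOff T u v → Meets T u i → Meets T v i := by
    intro u v huv ⟨m, hm⟩
    by_contra hv
    have hv' : ∀ m, (v.right ^ m) i ∉ T := fun m hm => hv ⟨m, hm⟩
    rw [(huv.pow (fun m _ => hv' m)).1] at hm
    exact hv' m hm
  exact ⟨key h, key h.symm⟩

theorem AgreeOff.cycle_eq (h : AgreeOff T x z) {i : Fin n} (hi : ¬ Meets T z i) :
    cycleLen x.right i = cycleLen z.right i ∧ clsAt x i = clsAt z i := by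
  have hz : ∀ m, (z.right ^ m) i ∉ T := fun m hm => hi ⟨m, hm⟩
  have hp : ∀ M, (x.right ^ M) i = (z.right ^ M) i ∧ lab (x ^ M) i = lab (z ^ M) i :=
    fun M => h.pow fun m _ => hz m
  have hl : cycleLen x.right i = cycleLen z.right i := by
    refine cycleLen_eq_of (cycleLen_pos _ _) ?_ ?_
    · rw [(hp _).1, pow_cycleLen]
    · intro m hm hm'
      rw [(hp _).1]
      exact pow_ne_of_lt_cycleLen hm hm'
  refine ⟨hl, ?_⟩
  rw [clsAt, clsAt, cycleProd_eq_lab, cycleProd_eq_lab, (hp _).2, hl]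

theorem meets_iff_sameCycle (x : Wreath Γ n) (i : Fin n) :
    Meets T x i ↔ ∃ t ∈ T, x.right.SameCycle t i := by
  constructor
  · rintro ⟨m, hm⟩
    exact ⟨_, hm, (sameCycle_pow x.right m i).symm⟩
  · rintro ⟨t, ht, h⟩
    obtain ⟨k, hk⟩ := h.symm.exists_nat_pow_eq
    exact ⟨k, hk ▸ ht⟩

/-- `y` is the first return map of `z` to `T`, with return times `k`, and trivial off `T`. -/
structure IsReturn (T : Finset (Fin n)) (z y : Wreath Γ n) (k : Fin n → ℕ) : Prop where
  triv : TrivOff T y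
  pos : ∀ t ∈ T, 0 < k t
  right : ∀ t ∈ T, y.right t = (z.right ^ k t) t
  label : ∀ t ∈ T, lab y t = lab (z ^ k t) t
  mem : ∀ t ∈ T, y.right t ∈ T
  avoid : ∀ t ∈ T, ∀ m, 0 < m → m < k t → (z.right ^ m) t ∉ T

theorem IsReturn.time_eq {k : Fin n → ℕ} (h : IsReturn T z y k) {t : Fin n} (ht : t ∈ T) {m : ℕ}
    (hm : 0 < m) (hmem : (z.right ^ m) t ∈ T) (hav : ∀ l, 0 < l → l < m → (z.right ^ l) t ∉ T) :
    k t = m := by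
  rcases lt_trichotomy (k t) m with h1 | h1 | h1
  · exact absurd (h.right t ht ▸ h.mem t ht) (hav _ (h.pos t ht) h1)
  · exact h1
  · exact absurd hmem (h.avoid t ht m hm h1)

theorem IsReturn.unique {y' : Wreath Γ n} {k k' : Fin n → ℕ} (h : IsReturn T z y k)
    (h' : IsReturn T z y' k') : y = y' := by
  have hk : ∀ t ∈ T, k t = k' t := fun t ht =>
    h.time_eq ht (h'.pos t ht) (h'.right t ht ▸ h'.mem t ht) (h'.avoid t ht)
  refine wreath_ext (fun i => ?_) (fun i => ?_)
  · by_cases hi : i ∈ T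
    · rw [h.right i hi, h'.right i hi, hk i hi]
    · rw [(h.triv i hi).1, (h'.triv i hi).1]
  · by_cases hi : i ∈ T
    · rw [h.label i hi, h'.label i hi, hk i hi]
    · rw [(h.triv i hi).2, (h'.triv i hi).2]

theorem exists_isReturn (T : Finset (Fin n)) (z : Wreath Γ n) :
    ∃ (y : Wreath Γ n) (k : Fin n → ℕ), IsReturn T z y k := by
  classical
  have hex : ∀ t : Fin n, t ∈ T → ∃ m, 0 < m ∧ (z.right ^ m) t ∈ T := fun t ht =>
    ⟨cycleLen z.right t, cycleLen_pos _ _, by rwa [pow_cycleLen]⟩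
  let k : Fin n → ℕ := fun t => if ht : t ∈ T then Nat.find (hex t ht) else 0
  have hkT : ∀ t (ht : t ∈ T), k t = Nat.find (hex t ht) := fun t ht => dif_pos ht
  have hpos : ∀ t ∈ T, 0 < k t := fun t ht => by
    rw [hkT t ht]; exact (Nat.find_spec (hex t ht)).1
  have hmem : ∀ t ∈ T, (z.right ^ k t) t ∈ T := fun t ht => by
    rw [hkT t ht]; exact (Nat.find_spec (hex t ht)).2
  have hav : ∀ t ∈ T, ∀ m, 0 < m → m < k t → (z.right ^ m) t ∉ T := fun t ht m hm hlt hm' => by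
    rw [hkT t ht] at hlt
    exact Nat.find_min (hex t ht) hlt ⟨hm, hm'⟩
  let f : Fin n → Fin n := fun t => if t ∈ T then (z.right ^ k t) t else t
  have hfT : ∀ t ∈ T, f t = (z.right ^ k t) t := fun t ht => if_pos ht
  have hfn : ∀ t ∉ T, f t = t := fun t ht => if_neg ht
  have key : ∀ t ∈ T, ∀ s ∈ T, k t ≤ k s → f t = f s → t = s := by
    intro t ht s hs hle h
    rw [hfT t ht, hfT s hs] at h
    obtain ⟨d, hd⟩ := Nat.exists_eq_add_of_le hle
    rw [hd, pow_add, Equiv.Perm.mul_apply, (z.right ^ k t).apply_eq_iff_eq] at h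
    rcases Nat.eq_zero_or_pos d with rfl | hd0
    · exact h
    · have := hpos t ht
      exact absurd (h ▸ ht) (hav s hs d hd0 (by omega))
  have hinj : Function.Injective f := by
    intro t s h
    by_cases ht : t ∈ T <;> by_cases hs : s ∈ T
    · rcases le_total (k t) (k s) with hle | hle
      · exact key t ht s hs hle h
      · exact (key s hs t ht hle h.symm).symm
    · rw [hfn s hs] at h
      exact absurd (h ▸ hfT t ht ▸ hmem t ht) hs
    · rw [hfn t ht] at h
      exact absurd (h ▸ hfT s hs ▸ hmem s hs) ht
    · rwa [hfn t ht, hfn s hs] at h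
  let σ : Equiv.Perm (Fin n) := Equiv.ofBijective f (Finite.injective_iff_bijective.1 hinj)
  have hσ : ∀ t, (ofLab σ (fun t => if t ∈ T then lab (z ^ k t) t else 1)).right t = f t :=
    fun t => rfl
  refine ⟨ofLab σ (fun t => if t ∈ T then lab (z ^ k t) t else 1), k, ?_, hpos, ?_, ?_, ?_, hav⟩
  · intro i hi
    rw [lab_ofLab, if_neg hi]
    exact ⟨hfn i hi, rfl⟩
  · exact hfT
  · intro t ht
    rw [lab_ofLab, if_pos ht]
  · intro t ht
    rw [hσ, hfT t ht]
    exact hmem t ht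

theorem pow_succ_of_agree {t : Fin n} {m : ℕ}
    (h : (x.right ^ m) (x.right (y.right t)) = ((x * y).right ^ m) (x.right (y.right t)) ∧
      lab (x ^ m) (x.right (y.right t)) = lab ((x * y) ^ m) (x.right (y.right t))) :
    (x.right ^ (m + 1)) (y.right t) = ((x * y).right ^ (m + 1)) t ∧
      lab ((x * y) ^ (m + 1)) t = lab (x ^ (m + 1)) (y.right t) * lab y t := by
  have hr : (x * y).right t = x.right (y.right t) := rfl
  rw [perm_pow_succ_apply, perm_pow_succ_apply, lab_pow_succ, lab_pow_succ, hr, h.1, h.2, lab_mul,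
    mul_assoc]
  exact ⟨rfl, rfl⟩

/-- If the cycles of `x` through the points of `T` are distinct with trivial cycle-product, then
`y` is the return map of `x * y` to `T`. -/
theorem isReturn_of_cycles (hy : TrivOff T y) (hT : ∀ t ∈ T, y.right t ∈ T)
    (hone : ∀ t ∈ T, cycleProd x t = 1) (hne : ∀ t ∈ T, ∀ s ∈ T, x.right.SameCycle t s → t = s) :
    IsReturn T (x * y) y (fun t => cycleLen x.right (y.right t)) := by
  have hag := hy.agreeOff x
  have hx : ∀ s ∈ T, ∀ m, 0 < m → m < cycleLen x.right s → (x.right ^ m) s ∉ T := by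
    intro s hs m hm hlt hmem
    exact pow_ne_of_lt_cycleLen hm hlt (hne s hs _ hmem (sameCycle_pow _ _ _)).symm
  have key : ∀ t ∈ T, ∀ m, 0 < m → m ≤ cycleLen x.right (y.right t) →
      (x.right ^ m) (y.right t) = ((x * y).right ^ m) t ∧
      lab ((x * y) ^ m) t = lab (x ^ m) (y.right t) * lab y t := by
    intro t ht m hm hle
    obtain ⟨m, rfl⟩ := Nat.exists_eq_succ_of_ne_zero hm.ne'
    have h := hag.symm.pow (i := x.right (y.right t)) (M := m) (by
      intro l hl
      rw [← perm_pow_succ_apply]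
      exact hx _ (hT t ht) _ (by omega) (by omega))
    exact pow_succ_of_agree ⟨h.1.symm, h.2.symm⟩
  refine ⟨hy, fun t _ => cycleLen_pos _ _, ?_, ?_, hT, ?_⟩
  · intro t ht
    rw [← (key t ht _ (cycleLen_pos _ _) le_rfl).1, pow_cycleLen]
  · intro t ht
    rw [(key t ht _ (cycleLen_pos _ _) le_rfl).2, ← cycleProd_eq_lab, hone _ (hT t ht), one_mul]
  · intro t ht m hm hlt
    rw [← (key t ht m hm hlt.le).1]
    exact hx _ (hT t ht) m hm hlt

theorem IsReturn.cycle_of_return {k : Fin n → ℕ} (h : IsReturn T (x * y) y k) {t : Fin n}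
    (ht : t ∈ T) :
    cycleLen x.right (y.right t) = k t ∧ cycleProd x (y.right t) = 1 ∧
      ∀ m, 0 < m → m < k t → (x.right ^ m) (y.right t) ∉ T := by
  have hag := h.triv.agreeOff x
  have key : ∀ m, 0 < m → m ≤ k t →
      (x.right ^ m) (y.right t) = ((x * y).right ^ m) t ∧
      lab ((x * y) ^ m) t = lab (x ^ m) (y.right t) * lab y t := by
    intro m hm hle
    obtain ⟨m, rfl⟩ := Nat.exists_eq_succ_of_ne_zero hm.ne'
    refine pow_succ_of_agree (hag.pow ?_)
    intro l hl
    change ((x * y).right ^ l) ((x * y).right t) ∉ T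
    rw [← perm_pow_succ_apply]
    exact h.avoid t ht _ (by omega) (by omega)
  have hav : ∀ m, 0 < m → m < k t → (x.right ^ m) (y.right t) ∉ T := by
    intro m hm hlt
    rw [(key m hm hlt.le).1]
    exact h.avoid t ht m hm hlt
  have hl : cycleLen x.right (y.right t) = k t := by
    refine cycleLen_eq_of (h.pos t ht) ?_ ?_
    · rw [(key _ (h.pos t ht) le_rfl).1, h.right t ht]
    · intro m hm hlt he
      exact hav m hm hlt (by rw [he]; exact h.mem t ht)
  refine ⟨hl, ?_, hav⟩
  have h2 := (key _ (h.pos t ht) le_rfl).2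
  rw [← h.label t ht] at h2
  rw [cycleProd_eq_lab, hl]
  exact mul_eq_right.1 h2.symm

theorem IsReturn.pow_mem {k : Fin n → ℕ} (h : IsReturn T z y k) {p : Fin n} (hp : p ∈ T) (j : ℕ) :
    (y.right ^ j) p ∈ T := by
  induction j with
  | zero => exact hp
  | succ j ih => rw [pow_succ', Equiv.Perm.mul_apply]; exact h.mem _ ih

theorem IsReturn.pow_eq {k : Fin n → ℕ} (h : IsReturn T z y k) {p : Fin n} (hp : p ∈ T) (j : ℕ) :
    (y.right ^ j) p = (z.right ^ (∑ i ∈ Finset.range j, k ((y.right ^ i) p))) p ∧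
      lab (y ^ j) p = lab (z ^ (∑ i ∈ Finset.range j, k ((y.right ^ i) p))) p := by
  induction j with
  | zero => exact ⟨rfl, rfl⟩
  | succ j ih =>
    have hj := h.pow_mem hp j
    constructor
    · rw [pow_succ', Equiv.Perm.mul_apply, h.right _ hj, Finset.sum_range_succ, add_comm, pow_add,
        Equiv.Perm.mul_apply, ← ih.1]
    · rw [pow_succ', lab_mul, right_pow, h.label _ hj, Finset.sum_range_succ, add_comm, lab_pow_add,
        ← ih.1, ← ih.2]

theorem IsReturn.exists_preimage {k : Fin n → ℕ} (h : IsReturn T z y k) {t : Fin n} (ht : t ∈ T) :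
    ∃ s ∈ T, y.right s = t := by
  refine ⟨y.right.symm t, ?_, Equiv.apply_symm_apply _ _⟩
  by_contra hs
  have := (h.triv _ hs).1
  rw [Equiv.apply_symm_apply] at this
  exact hs (this ▸ ht)

open Classical in
/-- Comparison of the cycles of `x` and of `x * y`, where `y` is a return map of `x * y`. -/
theorem IsReturn.sum_eq {k : Fin n → ℕ} (h : IsReturn T (x * y) y k) {p : Fin n} (hp : p ∈ T)
    (hT : ∀ t ∈ T, (x * y).right.SameCycle p t) (F : ℕ → ConjClasses Γ → ℕ) :
    (∑ i, F (cycleLen x.right i) (clsAt x i)) +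
        cycleLen (x * y).right p * F (cycleLen (x * y).right p) (clsAt (x * y) p) =
      (∑ i, F (cycleLen (x * y).right i) (clsAt (x * y) i)) + ∑ t ∈ T, k t * F (k t) 1 := by
  have hag := h.triv.agreeOff x
  have hx : ∑ i with Meets T x i, F (cycleLen x.right i) (clsAt x i) =
      ∑ t ∈ T, k t * F (k t) 1 := by
    have hD : Finset.univ.filter (fun i => Meets T x i) =
        T.biUnion fun t => Finset.univ.filter fun i => x.right.SameCycle (y.right t) i := by
      ext i
      simp only [Finset.mem_filter, Finset.mem_univ, true_and, Finset.mem_biUnion]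
      rw [meets_iff_sameCycle]
      constructor
      · rintro ⟨t, ht, hti⟩
        obtain ⟨s, hs, rfl⟩ := h.exists_preimage ht
        exact ⟨s, hs, hti⟩
      · rintro ⟨s, hs, hsi⟩
        exact ⟨_, h.mem s hs, hsi⟩
    rw [hD, Finset.sum_biUnion]
    · refine Finset.sum_congr rfl fun t ht => ?_
      obtain ⟨h1, h2, -⟩ := h.cycle_of_return ht
      rw [Finset.sum_congr rfl (g := fun _ => F (k t) 1)]
      · rw [Finset.sum_const, card_filter_sameCycle, h1, smul_eq_mul]
      · intro i hi
        have hi' : x.right.SameCycle (y.right t) i := by simpa using hi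
        rw [← cycleLen_congr hi', ← clsAt_congr hi', h1, (clsAt_eq_one_iff _ _).2 h2]
    · intro t ht s hs hts
      rw [Function.onFun, Finset.disjoint_left]
      intro i hi hi'
      have h1 : x.right.SameCycle (y.right t) i := by simpa using hi
      have h2 : x.right.SameCycle (y.right s) i := by simpa using hi'
      obtain ⟨m, hm, hm'⟩ := exists_pow_lt_of_sameCycle (h1.trans h2.symm)
      obtain ⟨h3, -, h4⟩ := h.cycle_of_return ht
      rw [h3] at hm
      rcases Nat.eq_zero_or_pos m with rfl | hm0
      · exact hts (y.right.injective hm')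
      · exact h4 m hm0 hm (hm' ▸ h.mem s hs)
  have hz : ∑ i with Meets T x i, F (cycleLen (x * y).right i) (clsAt (x * y) i) =
      cycleLen (x * y).right p * F (cycleLen (x * y).right p) (clsAt (x * y) p) := by
    have hD : Finset.univ.filter (fun i => Meets T x i) =
        Finset.univ.filter fun i => (x * y).right.SameCycle p i := by
      ext i
      simp only [Finset.mem_filter, Finset.mem_univ, true_and]
      rw [hag.meets_iff, meets_iff_sameCycle]
      exact ⟨fun ⟨t, ht, hti⟩ => (hT t ht).trans hti, fun hi => ⟨p, hp, hi⟩⟩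
    rw [hD, Finset.sum_congr rfl
      (g := fun _ => F (cycleLen (x * y).right p) (clsAt (x * y) p))]
    · rw [Finset.sum_const, card_filter_sameCycle, smul_eq_mul]
    · intro i hi
      have hi' : (x * y).right.SameCycle p i := by simpa using hi
      rw [← cycleLen_congr hi', ← clsAt_congr hi']
  have hn : ∑ i with ¬ Meets T x i, F (cycleLen x.right i) (clsAt x i) =
      ∑ i with ¬ Meets T x i, F (cycleLen (x * y).right i) (clsAt (x * y) i) := by
    refine Finset.sum_congr rfl fun i hi => ?_
    have hi' : ¬ Meets T x i := by simpa using hi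
    rw [hag.meets_iff] at hi'
    rw [(hag.cycle_eq hi').1, (hag.cycle_eq hi').2]
  rw [← Finset.sum_filter_add_sum_filter_not Finset.univ (fun i => Meets T x i), hx, hn,
    ← Finset.sum_filter_add_sum_filter_not Finset.univ (fun i => Meets T x i)
      (fun i => F (cycleLen (x * y).right i) (clsAt (x * y) i)), hz]
  ring

end Agree

section SingleCycle

theorem Partn.pred_eq_zero_iff (μ : Partn) : μ.pred = 0 ↔ ∀ a ∈ μ, a = 1 := by
  induction μ using Multiset.induction_on with
  | empty => simp [Partn.pred]
  | cons a W ih =>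
    rw [pred_cons, add_eq_zero, ih, Multiset.forall_mem_cons]
    refine and_congr_left fun _ => ?_
    split_ifs with h
    · simp [h.ne']
    · simpa using h

variable {Γ : Type*} [Group Γ] {n : ℕ} {T : Finset (Fin n)} {x y z : Wreath Γ n}

theorem PartnFun.at_same (c : ConjClasses Γ) (μ : Partn) : PartnFun.at c μ c = μ := by
  simp [PartnFun.at]

theorem PartnFun.at_ne {c d : ConjClasses Γ} (h : d ≠ c) (μ : Partn) : PartnFun.at c μ d = 0 := by
  simp [PartnFun.at, h]

/-- The length of a cycle, as a positive integer. -/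
noncomputable def pLen (x : Wreath Γ n) (i : Fin n) : ℕ+ :=
  ⟨cycleLen x.right i, cycleLen_pos _ _⟩

theorem pLen_mem_wreathType (x : Wreath Γ n) (i : Fin n) :
    pLen x i ∈ wreathType x (clsAt x i) := by
  classical
  have h := card_points x (clsAt x i) (pLen x i)
  rw [← Multiset.count_pos]
  refine Nat.pos_of_ne_zero fun h0 => ?_
  rw [h0, mul_zero, Finset.card_eq_zero] at h
  have : i ∈ (∅ : Finset (Fin n)) := by
    rw [← h]
    exact Finset.mem_filter.2 ⟨Finset.mem_univ _, rfl, rfl⟩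
  simp at this

theorem exists_of_mem_wreathType {x : Wreath Γ n} {c : ConjClasses Γ} {k : ℕ+}
    (h : k ∈ wreathType x c) : ∃ i, clsAt x i = c ∧ cycleLen x.right i = k := by
  classical
  have h' := card_points x c k
  have : 0 < (Finset.univ.filter (fun i => clsAt x i = c ∧ cycleLen x.right i = k)).card := by
    rw [h']
    exact Nat.mul_pos k.pos (Multiset.count_pos.2 h)
  obtain ⟨i, hi⟩ := Finset.card_pos.1 this
  exact ⟨i, by simpa using hi⟩

theorem TrivOff.cycle (h : TrivOff T y) {i : Fin n} (hi : i ∉ T) :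
    cycleLen y.right i = 1 ∧ clsAt y i = 1 := by
  have hl : cycleLen y.right i = 1 :=
    cycleLen_eq_of one_pos (by rw [pow_one, (h i hi).1]) (by omega)
  refine ⟨hl, ?_⟩
  rw [clsAt_eq_one_iff, cycleProd_eq_lab, hl, pow_one, (h i hi).2]

/-- The points of the cycle of an element of modified type `(r)_c`. -/
noncomputable def clsSet (y : Wreath Γ n) (c : ConjClasses Γ) : Finset (Fin n) := by
  classical exact Finset.univ.filter (fun i => clsAt y i = c)

theorem mem_clsSet {c : ConjClasses Γ} {i : Fin n} : i ∈ clsSet y c ↔ clsAt y i = c := by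
  simp [clsSet]

variable {r : ℕ+} {c : ConjClasses Γ}

theorem cycleLen_of_modType (hc : c ≠ 1) (hy : modType y = PartnFun.cycle r c) {i : Fin n}
    (hi : i ∈ clsSet y c) : cycleLen y.right i = r := by
  have h := pLen_mem_wreathType y i
  rw [mem_clsSet.1 hi, ← modType_of_ne y hc, hy, PartnFun.cycle, PartnFun.at_same,
    Multiset.mem_singleton] at h
  exact congrArg PNat.val h

theorem card_clsSet_of_modType (hc : c ≠ 1) (hy : modType y = PartnFun.cycle r c) :
    (clsSet y c).card = r := by
  classical
  have h := card_points y c r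
  rw [← modType_of_ne y hc, hy, PartnFun.cycle, PartnFun.at_same, Multiset.count_singleton_self,
    mul_one] at h
  rw [← h]
  congr 1
  ext i
  simp only [Finset.mem_filter, Finset.mem_univ, true_and, mem_clsSet]
  exact ⟨fun hi => ⟨hi, cycleLen_of_modType hc hy (mem_clsSet.2 hi)⟩, fun hi => hi.1⟩

theorem trivOff_of_modType (hy : modType y = PartnFun.cycle r c) : TrivOff (clsSet y c) y := by
  intro i hi
  rw [mem_clsSet] at hi
  have h := pLen_mem_wreathType y i
  by_cases h1 : clsAt y i = 1
  · rw [h1] at hi h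
    have h0 : (wreathType y 1).pred = 0 := by
      rw [← modType_one, hy, PartnFun.cycle, PartnFun.at_ne hi]
    have hl : cycleLen y.right i = 1 :=
      congrArg PNat.val ((Partn.pred_eq_zero_iff _).1 h0 _ h)
    have hp := pow_cycleLen y.right i
    have hq := (clsAt_eq_one_iff y i).1 h1
    rw [hl, pow_one] at hp
    rw [cycleProd_eq_lab, hl, pow_one] at hq
    exact ⟨hp, hq⟩
  · rw [← modType_of_ne y h1, hy, PartnFun.cycle, PartnFun.at_ne hi] at h
    exact absurd h (Multiset.notMem_zero _)

theorem sameCycle_of_modType (hc : c ≠ 1) (hy : modType y = PartnFun.cycle r c) {p t : Fin n}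
    (hp : p ∈ clsSet y c) (ht : t ∈ clsSet y c) : y.right.SameCycle p t := by
  classical
  have hsub : Finset.univ.filter (fun j => y.right.SameCycle p j) ⊆ clsSet y c := by
    intro j hj
    have hj' : y.right.SameCycle p j := by simpa using hj
    rw [mem_clsSet, ← clsAt_congr hj', mem_clsSet.1 hp]
  have heq := Finset.eq_of_subset_of_card_le hsub (by
    rw [card_filter_sameCycle, card_clsSet_of_modType hc hy, cycleLen_of_modType hc hy hp])
  rw [← heq] at ht
  simpa using ht

theorem modType_eq_cycle (hc : c ≠ 1) (hy : TrivOff T y) {p : Fin n}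
    (hT : ∀ t, t ∈ T ↔ y.right.SameCycle p t) (hr : cycleLen y.right p = r)
    (hcl : clsAt y p = c) : modType y = PartnFun.cycle r c := by
  classical
  have hin : ∀ i ∈ T, cycleLen y.right i = r ∧ clsAt y i = c := fun i hi => by
    rw [← cycleLen_congr ((hT i).1 hi), ← clsAt_congr ((hT i).1 hi)]
    exact ⟨hr, hcl⟩
  funext d
  rcases eq_or_ne d 1 with rfl | hd
  · rw [modType_one, PartnFun.cycle, PartnFun.at_ne hc.symm, Partn.pred_eq_zero_iff]
    intro a ha
    obtain ⟨i, h1, h2⟩ := exists_of_mem_wreathType ha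
    have hi : i ∉ T := fun hi => hc ((hin i hi).2.symm.trans h1)
    rw [(hy.cycle hi).1] at h2
    exact PNat.eq h2.symm
  · rw [modType_of_ne y hd]
    have hdT : ∀ i, clsAt y i = d → i ∈ T := fun i h => by
      by_contra hi
      exact hd (h.symm.trans (hy.cycle hi).2)
    rcases eq_or_ne d c with rfl | hdc
    · rw [PartnFun.cycle, PartnFun.at_same]
      ext a
      rw [Multiset.count_singleton]
      have h := card_points y d a
      split_ifs with har
      · subst har
        have hTa : Finset.univ.filter (fun i => clsAt y i = d ∧ cycleLen y.right i = a) =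
            Finset.univ.filter (fun i => y.right.SameCycle p i) := by
          ext i
          simp only [Finset.mem_filter, Finset.mem_univ, true_and]
          rw [← hT]
          exact ⟨fun h => hdT i h.1, fun h => (hin i h).symm⟩
        rw [hTa, card_filter_sameCycle, hr] at h
        exact Nat.eq_of_mul_eq_mul_left a.pos (by rw [← h, mul_one])
      · by_contra h0
        obtain ⟨i, h1, h2⟩ := exists_of_mem_wreathType (Multiset.count_ne_zero.1 h0)
        rw [(hin i (hdT i h1)).1] at h2
        exact har (PNat.eq h2.symm)
    · rw [PartnFun.cycle, PartnFun.at_ne hdc, Multiset.eq_zero_iff_forall_notMem]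
      intro a ha
      obtain ⟨i, h1, -⟩ := exists_of_mem_wreathType ha
      exact hdc (h1.symm.trans (hin i (hdT i h1)).2)

end SingleCycle

section DegreeCount

variable {Γ : Type*} [Group Γ] {n : ℕ} {T : Finset (Fin n)} {x y z : Wreath Γ n}

theorem AgreeOff.card_le (h : AgreeOff T x z) (S : Finset (Fin n))
    (hS : ∀ i, clsAt x i = 1 → Meets T x i → ∃ s ∈ S, x.right.SameCycle s i) :
    Multiset.card (wreathType x 1) ≤ Multiset.card (wreathType z 1) + S.card := by
  classical
  let w : Wreath Γ n → Fin n → ℚ := fun u i =>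
    if clsAt u i = 1 then (cycleLen u.right i : ℚ)⁻¹ else 0
  have hw : ∀ u i, 0 ≤ w u i := fun u i => by
    simp only [w]; split_ifs <;> positivity
  have hcyc : ∀ s, ∑ i with x.right.SameCycle s i, w x i ≤ 1 := fun s => by
    rw [Finset.sum_congr rfl (g := fun _ => w x s)]
    · rw [Finset.sum_const, card_filter_sameCycle, nsmul_eq_mul]
      have : (cycleLen x.right s : ℚ) ≠ 0 := by exact_mod_cast (cycleLen_pos _ _).ne'
      simp only [w]
      split_ifs
      · rw [mul_inv_cancel₀ this]
      · simp
    · intro i hi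
      have hi' : x.right.SameCycle s i := by simpa using hi
      simp only [w, ← cycleLen_congr hi', ← clsAt_congr hi']
  have h1 : ∑ i with Meets T x i, w x i ≤ S.card := by
    calc ∑ i with Meets T x i, w x i
        ≤ ∑ i, ∑ s ∈ S, (if x.right.SameCycle s i then w x i else 0) := by
          rw [Finset.sum_filter]
          refine Finset.sum_le_sum fun i _ => ?_
          have hnn : ∀ s ∈ S, 0 ≤ (if x.right.SameCycle s i then w x i else 0) := fun s _ => by
            split_ifs
            · exact hw x i
            · exact le_rfl
          split_ifs with hm
          · by_cases h1 : clsAt x i = 1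
            · obtain ⟨s, hs, hsi⟩ := hS i h1 hm
              have := Finset.single_le_sum hnn hs
              rwa [if_pos hsi] at this
            · have : w x i = 0 := if_neg h1
              rw [this]
              simp
          · exact Finset.sum_nonneg hnn
      _ = ∑ s ∈ S, ∑ i with x.right.SameCycle s i, w x i := by
          rw [Finset.sum_comm]
          simp only [Finset.sum_filter]
      _ ≤ ∑ s ∈ S, 1 := Finset.sum_le_sum fun s _ => hcyc s
      _ = S.card := by simp
  have h2 : ∑ i with ¬ Meets T x i, w x i ≤ ∑ i, w z i := by
    calc ∑ i with ¬ Meets T x i, w x i = ∑ i with ¬ Meets T x i, w z i := by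
          refine Finset.sum_congr rfl fun i hi => ?_
          have hi' : ¬ Meets T x i := by simpa using hi
          rw [h.meets_iff] at hi'
          simp only [w, (h.cycle_eq hi').1, (h.cycle_eq hi').2]
      _ ≤ _ := Finset.sum_le_sum_of_subset_of_nonneg (Finset.filter_subset _ _)
          fun i _ _ => hw z i
  have h3 := Finset.sum_filter_add_sum_filter_not Finset.univ (fun i => Meets T x i) (w x)
  have hx := card_wreathType_one x
  have hz := card_wreathType_one z
  have : (Multiset.card (wreathType x 1) : ℚ) ≤ Multiset.card (wreathType z 1) + S.card := by
    rw [← hx, ← hz]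
    change ∑ i, w x i ≤ ∑ i, w z i + _
    linarith
  exact_mod_cast this

variable {r : ℕ+} {c : ConjClasses Γ}

theorem isReturn_of_deg [Finite Γ] (hc : c ≠ 1) (hy : modType y = PartnFun.cycle r c)
    (hdeg : (modType (x * y)).deg = (modType x).deg + r) :
    IsReturn (clsSet y c) (x * y) y (fun t => cycleLen x.right (y.right t)) := by
  have htriv := trivOff_of_modType hy
  have hcard : Multiset.card (wreathType x 1) = Multiset.card (wreathType (x * y) 1) + r := by
    have h1 := deg_modType_add_card x
    have h2 := deg_modType_add_card (x * y)
    omega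
  have key : ∀ t ∈ clsSet y c,
      ¬ ∀ i, clsAt x i = 1 → Meets (clsSet y c) x i →
        ∃ s ∈ (clsSet y c).erase t, x.right.SameCycle s i := by
    intro t ht h
    have h1 := (htriv.agreeOff x).card_le _ h
    rw [Finset.card_erase_of_mem ht, card_clsSet_of_modType hc hy] at h1
    have := r.pos
    omega
  refine isReturn_of_cycles htriv ?_ ?_ ?_
  · intro t ht
    rw [mem_clsSet, clsAt_apply, mem_clsSet.1 ht]
  · intro t ht
    by_contra hne
    refine key t ht fun i hi hm => ?_
    obtain ⟨s, hs, hsi⟩ := (meets_iff_sameCycle x i).1 hm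
    refine ⟨s, Finset.mem_erase.2 ⟨?_, hs⟩, hsi⟩
    rintro rfl
    rw [← clsAt_congr hsi, clsAt_eq_one_iff] at hi
    exact hne hi
  · intro t ht s hs hts
    by_contra hne
    refine key t ht fun i hi hm => ?_
    obtain ⟨u, hu, hui⟩ := (meets_iff_sameCycle x i).1 hm
    by_cases hut : u = t
    · subst hut
      exact ⟨s, Finset.mem_erase.2 ⟨fun h => hne h.symm, hs⟩, hts.symm.trans hui⟩
    · exact ⟨u, Finset.mem_erase.2 ⟨hut, hu⟩, hui⟩

end DegreeCount

section TypeComparison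

variable {Γ : Type*} [Group Γ] {n : ℕ} {T : Finset (Fin n)} {x y z : Wreath Γ n} {r : ℕ+}

/-- The multiset of values of a finite sequence of positive integers. -/
def partOf {r : ℕ} (kk : Fin r → ℕ+) : Partn := Finset.univ.val.map kk

theorem IsReturn.type_eq {k : Fin n → ℕ} (h : IsReturn T (x * y) y k) {p : Fin n} (hp : p ∈ T)
    (hT : ∀ t, t ∈ T ↔ y.right.SameCycle p t) (hr : cycleLen y.right p = r) (kk : Fin r → ℕ+)
    (hkk : ∀ j, (kk j : ℕ) = k ((y.right ^ (j : ℕ)) p)) :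
    ∑ j, (kk j : ℕ) = cycleLen (x * y).right p ∧ clsAt (x * y) p = clsAt y p ∧
      wreathType x + PartnFun.at (clsAt (x * y) p) {pLen (x * y) p} =
        wreathType (x * y) + PartnFun.at 1 (partOf kk) := by
  classical
  have hTz : ∀ t ∈ T, (x * y).right.SameCycle p t := by
    intro t ht
    obtain ⟨m, rfl⟩ := ((hT t).1 ht).exists_nat_pow_eq
    rw [(h.pow_eq hp m).1]
    exact sameCycle_pow _ _ _
  have hsumT : ∀ G : ℕ → ℕ, ∑ t ∈ T, G (k t) = ∑ j, G (kk j) := by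
    intro G
    have hTi : T = (Finset.range r).image (fun m => (y.right ^ m) p) := by
      rw [← hr, ← filter_sameCycle_eq_image]
      ext t
      simp [hT]
    rw [hTi, Finset.sum_image, Finset.sum_range]
    · exact Finset.sum_congr rfl fun j _ => by rw [hkk]
    · intro a ha b hb hab
      have ha' : a < r := by simpa using ha
      have hb' : b < r := by simpa using hb
      exact pow_injOn_cycleLen (hr ▸ ha') (hr ▸ hb') hab
  have hL : ∑ j, (kk j : ℕ) = cycleLen (x * y).right p := by
    have h1 := h.sum_eq hp hTz (fun _ _ => 1)
    have h2 := hsumT fun a => a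
    simp only [mul_one] at h1
    omega
  have hrange : ∑ i ∈ Finset.range r, k ((y.right ^ i) p) = cycleLen (x * y).right p := by
    rw [← hL, Finset.sum_range]
    exact Finset.sum_congr rfl fun j _ => (hkk j).symm
  refine ⟨hL, ?_, ?_⟩
  · have h1 := (h.pow_eq hp r).2
    rw [hrange, ← cycleProd_eq_lab, ← hr, ← cycleProd_eq_lab] at h1
    rw [clsAt, clsAt, h1]
  · funext e
    ext a
    have h1 := h.sum_eq hp hTz (fun l d => if d = e ∧ l = a then 1 else 0)
    rw [hsumT (fun l => l * if (1 : ConjClasses Γ) = e ∧ l = a then 1 else 0)] at h1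
    rw [← Finset.card_filter, ← Finset.card_filter, card_points, card_points] at h1
    have h2 : (Multiset.count a (PartnFun.at (clsAt (x * y) p) {pLen (x * y) p} e)) * a =
        cycleLen (x * y).right p *
          if clsAt (x * y) p = e ∧ cycleLen (x * y).right p = a then 1 else 0 := by
      by_cases he : clsAt (x * y) p = e
      · rw [he, PartnFun.at_same, Multiset.count_singleton]
        by_cases ha : a = pLen (x * y) p
        · have ha' : cycleLen (x * y).right p = a := by rw [ha]; rfl
          rw [if_pos ha, if_pos ⟨rfl, ha'⟩, ha']
          ring
        · have ha' : cycleLen (x * y).right p ≠ a := fun h' => ha (PNat.eq h'.symm)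
          rw [if_neg ha, if_neg (fun h' => ha' h'.2)]
          ring
      · rw [PartnFun.at_ne (Ne.symm he)]
        simp [he]
    have h3 : (Multiset.count a (PartnFun.at (1 : ConjClasses Γ) (partOf kk) e)) * a =
        ∑ j, (kk j : ℕ) * if (1 : ConjClasses Γ) = e ∧ (kk j : ℕ) = a then 1 else 0 := by
      by_cases he : 1 = e
      · subst he
        rw [PartnFun.at_same, partOf, Multiset.count_map, ← Finset.filter_val, Finset.card_val,
          Finset.card_filter, Finset.sum_mul]
        refine Finset.sum_congr rfl fun j _ => ?_
        by_cases hj : a = kk j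
        · simp [hj]
        · have hj' : (kk j : ℕ) ≠ a := fun h' => hj (PNat.eq h'.symm)
          simp [hj, hj']
      · rw [PartnFun.at_ne (Ne.symm he)]
        simp [he]
    rw [← h2, ← h3] at h1
    rw [Pi.add_apply, Pi.add_apply, Multiset.count_add, Multiset.count_add]
    refine Nat.eq_of_mul_eq_mul_left a.pos ?_
    linarith

theorem modType_add_eq {c : ConjClasses Γ} (hc : c ≠ 1) {x z : Wreath Γ n} {K : Partn} {L : ℕ+}
    (h : wreathType x + PartnFun.at c {L} = wreathType z + PartnFun.at 1 K) :
    modType x + PartnFun.at c {L} = modType z + PartnFun.at 1 K.pred := by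
  funext e
  have he := congrFun h e
  rw [Pi.add_apply, Pi.add_apply] at he ⊢
  rcases eq_or_ne e 1 with rfl | h1
  · rw [PartnFun.at_ne hc.symm, PartnFun.at_same, add_zero] at he ⊢
    rw [modType_one, modType_one, he, Partn.pred_add]
  · rw [PartnFun.at_ne h1] at he ⊢
    rwa [modType_of_ne x h1, modType_of_ne z h1]

end TypeComparison

section Bijection

variable {Γ : Type*} [Group Γ] {n : ℕ} {r : ℕ+} {c : ConjClasses Γ}

/-- The factors `y` of modified type `(r)_c` of `z` with a factor `z y⁻¹` of modified type `lam`. -/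
def factors (z : Wreath Γ n) (lam : PartnFun Γ) (r : ℕ+) (c : ConjClasses Γ) :
    Set (Wreath Γ n) :=
  {y | modType y = PartnFun.cycle r c ∧ modType (z * y⁻¹) = lam}

/-- The factors together with a point of their cycle. -/
def pointedFactors (z : Wreath Γ n) (lam : PartnFun Γ) (r : ℕ+) (c : ConjClasses Γ) :
    Set (Wreath Γ n × Fin n) :=
  {a | a.1 ∈ factors z lam r c ∧ clsAt a.1 a.2 = c}

/-- The possible sequences of return times, with a base point. -/
def returnData (z : Wreath Γ n) (lam : PartnFun Γ) (r : ℕ+) (c : ConjClasses Γ) :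
    Set (Fin n × (Fin r → ℕ+)) :=
  {b | clsAt z b.1 = c ∧ ∑ j, (b.2 j : ℕ) = cycleLen z.right b.1 ∧
    lam + PartnFun.at c {pLen z b.1} = modType z + PartnFun.at 1 (partOf b.2).pred}

/-- The sequence of return times of a pointed factor. -/
noncomputable def returnTimes (z : Wreath Γ n) (r : ℕ+) (a : Wreath Γ n × Fin n) :
    Fin n × (Fin r → ℕ+) :=
  (a.2, fun j => pLen (z * a.1⁻¹) (a.1.right ((a.1.right ^ (j : ℕ)) a.2)))

theorem isReturn_of_mem_factors [Finite Γ] (hc : c ≠ 1) {z y : Wreath Γ n} {lam : PartnFun Γ}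
    (hdeg : (modType z).deg = lam.deg + r) (hy : y ∈ factors z lam r c) :
    IsReturn (clsSet y c) z y (fun t => cycleLen (z * y⁻¹).right (y.right t)) := by
  obtain ⟨x, rfl⟩ : ∃ x, z = x * y := ⟨z * y⁻¹, by group⟩
  obtain ⟨h1, h2⟩ := hy
  rw [mul_inv_cancel_right] at h2 ⊢
  exact isReturn_of_deg hc h1 (by rw [hdeg, h2])

theorem returnTimes_mapsTo [Finite Γ] (hc : c ≠ 1) {z : Wreath Γ n} {lam : PartnFun Γ}
    (hdeg : (modType z).deg = lam.deg + r) :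
    Set.MapsTo (returnTimes z r) (pointedFactors z lam r c) (returnData z lam r c) := by
  rintro ⟨y, p⟩ ⟨hy, hp⟩
  have h := isReturn_of_mem_factors hc hdeg hy
  obtain ⟨x, rfl⟩ : ∃ x, z = x * y := ⟨z * y⁻¹, by group⟩
  obtain ⟨h1, h2⟩ := hy
  have hp' : p ∈ clsSet y c := mem_clsSet.2 hp
  have hT : ∀ t, t ∈ clsSet y c ↔ y.right.SameCycle p t := fun t =>
    ⟨sameCycle_of_modType hc h1 hp', fun ht => mem_clsSet.2 (by rw [← clsAt_congr ht]; exact hp)⟩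
  obtain ⟨h3, h4, h5⟩ := h.type_eq hp' hT (cycleLen_of_modType hc h1 hp')
    (returnTimes (x * y) r (y, p)).2 (fun j => rfl)
  replace hp : clsAt y p = c := hp
  have h6 : clsAt (x * y) p = c := h4.trans hp
  rw [h6] at h5
  refine ⟨h6, h3, ?_⟩
  dsimp only at h2
  rw [mul_inv_cancel_right] at h2
  rw [← h2]
  exact modType_add_eq hc h5

theorem returnTimes_injOn [Finite Γ] (hc : c ≠ 1) {z : Wreath Γ n} {lam : PartnFun Γ}
    (hdeg : (modType z).deg = lam.deg + r) :
    Set.InjOn (returnTimes z r) (pointedFactors z lam r c) := by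
  have points : ∀ {y : Wreath Γ n} {p : Fin n}, (y, p) ∈ pointedFactors z lam r c →
      clsSet y c = (Finset.univ : Finset (Fin r)).image (fun j : Fin r =>
        (z.right ^ ∑ i ∈ Finset.range (j : ℕ), if h : i < r then
          ((returnTimes z r (y, p)).2 ⟨i, h⟩ : ℕ) else 0) p) := by
    intro y p hy
    have h := isReturn_of_mem_factors hc hdeg hy.1
    have hp : p ∈ clsSet y c := mem_clsSet.2 hy.2
    have hpow : ∀ j : Fin r, (y.right ^ (j : ℕ)) p =
        (z.right ^ ∑ i ∈ Finset.range (j : ℕ), if h : i < r then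
          ((returnTimes z r (y, p)).2 ⟨i, h⟩ : ℕ) else 0) p := by
      intro j
      rw [(h.pow_eq hp j).1]
      congr 2
      refine Finset.sum_congr rfl fun i hi => ?_
      have hi' : i < r := (Finset.mem_range.1 hi).trans j.2
      rw [dif_pos hi']
      rfl
    ext t
    simp only [Finset.mem_image, Finset.mem_univ, true_and]
    simp only [← hpow]
    constructor
    · intro ht
      obtain ⟨m, hm, hmt⟩ := exists_pow_lt_of_sameCycle (sameCycle_of_modType hc hy.1.1 hp ht)
      rw [cycleLen_of_modType hc hy.1.1 hp] at hm
      exact ⟨⟨m, hm⟩, hmt⟩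
    · rintro ⟨j, rfl⟩
      exact h.pow_mem hp j
  rintro ⟨y, p⟩ hy ⟨y', p'⟩ hy' heq
  obtain rfl : p = p' := congrArg Prod.fst heq
  have hT : clsSet y c = clsSet y' c := by rw [points hy, points hy', heq]
  have h := isReturn_of_mem_factors hc hdeg hy.1
  have h' := isReturn_of_mem_factors hc hdeg hy'.1
  change IsReturn (clsSet y c) z y _ at h
  rw [hT] at h
  rw [h.unique h']

theorem returnTimes_surjOn (hc : c ≠ 1) (z : Wreath Γ n) (lam : PartnFun Γ) :
    Set.SurjOn (returnTimes z r) (pointedFactors z lam r c) (returnData z lam r c) := by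
  classical
  rintro ⟨p, kk⟩ ⟨hcl, hsum, htype⟩
  dsimp only at hcl hsum htype
  let κ : ℕ → ℕ := fun i => if h : i < r then kk ⟨i, h⟩ else 0
  let s : ℕ → ℕ := fun j => ∑ i ∈ Finset.range j, κ i
  have hκ : ∀ j : Fin r, κ j = kk j := fun j => dif_pos j.2
  have hκ0 : ∀ i < (r : ℕ), 0 < κ i := fun i hi => by
    have := hκ ⟨i, hi⟩
    dsimp only at this
    rw [this]
    exact (kk _).pos
  have hs0 : s 0 = 0 := rfl
  have hss : ∀ j, s (j + 1) = s j + κ j := fun j => Finset.sum_range_succ _ _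
  have hsr : s r = cycleLen z.right p := by
    rw [← hsum]
    change ∑ i ∈ Finset.range r, κ i = _
    rw [Finset.sum_range]
    exact Finset.sum_congr rfl fun j _ => hκ j
  have hmono : Monotone s := monotone_nat_of_le_succ fun j => by rw [hss]; omega
  have hlt : ∀ i < (r : ℕ), s i < s r := fun i hi => by
    have h1 := hmono (Nat.succ_le_of_lt hi)
    have h2 := hκ0 i hi
    rw [Nat.succ_eq_add_one, hss] at h1
    omega
  let T : Finset (Fin n) := (Finset.range r).image fun j => (z.right ^ s j) p
  have hTmem : ∀ j ≤ (r : ℕ), (z.right ^ s j) p ∈ T := by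
    intro j hj
    rcases hj.lt_or_eq with hj | rfl
    · exact Finset.mem_image_of_mem _ (Finset.mem_range.2 hj)
    · rw [hsr, pow_cycleLen]
      exact Finset.mem_image.2 ⟨0, Finset.mem_range.2 r.pos, by rw [hs0]; rfl⟩
  have hpT : p ∈ T := by simpa [hs0] using hTmem 0 (Nat.zero_le _)
  obtain ⟨y, k, hret⟩ := exists_isReturn T z
  have hk : ∀ j < (r : ℕ), k ((z.right ^ s j) p) = κ j := by
    intro j hj
    refine hret.time_eq (hTmem j hj.le) (hκ0 j hj) ?_ ?_
    · rw [← Equiv.Perm.mul_apply, ← pow_add, add_comm, ← hss]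
      exact hTmem (j + 1) hj
    · intro l hl hlj hmem
      rw [← Equiv.Perm.mul_apply, ← pow_add] at hmem
      obtain ⟨i, hi, hie⟩ := Finset.mem_image.1 hmem
      have hir := Finset.mem_range.1 hi
      have h1 := hlt i hir
      have h2 := hmono (Nat.succ_le_of_lt hj)
      rw [Nat.succ_eq_add_one, hss] at h2
      have h3 := pow_injOn_cycleLen (by omega) (by omega) hie
      rcases le_or_gt i j with hij | hij
      · have := hmono hij
        omega
      · have := hmono (Nat.succ_le_of_lt hij)
        rw [Nat.succ_eq_add_one, hss] at this
        omega
  have hy : ∀ j ≤ (r : ℕ), (y.right ^ j) p = (z.right ^ s j) p := by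
    intro j
    induction j with
    | zero => intro _; rfl
    | succ j ih =>
      intro hj
      rw [pow_succ', Equiv.Perm.mul_apply, ih (by omega), hret.right _ (hTmem j (by omega)),
        hk j hj, ← Equiv.Perm.mul_apply, ← pow_add, add_comm, ← hss]
  have hr : cycleLen y.right p = r := by
    refine cycleLen_eq_of r.pos ?_ ?_
    · rw [hy r le_rfl, hsr, pow_cycleLen]
    · intro m hm hmr
      rw [hy m hmr.le]
      have h1 := hlt m hmr
      have h2 := hmono (Nat.succ_le_of_lt hm)
      have h3 := hκ0 0 r.pos
      rw [Nat.succ_eq_add_one, hss, hs0] at h2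
      exact pow_ne_of_lt_cycleLen (by omega) (by omega)
  have hT : ∀ t, t ∈ T ↔ y.right.SameCycle p t := by
    intro t
    constructor
    · intro ht
      obtain ⟨j, hj, rfl⟩ := Finset.mem_image.1 ht
      rw [← hy j (Finset.mem_range.1 hj).le]
      exact sameCycle_pow _ _ _
    · intro ht
      obtain ⟨m, rfl⟩ := ht.exists_nat_pow_eq
      exact hret.pow_mem hpT m
  obtain ⟨x, rfl⟩ : ∃ x, z = x * y := ⟨z * y⁻¹, by group⟩
  have hkk : ∀ j : Fin r, (kk j : ℕ) = k ((y.right ^ (j : ℕ)) p) := fun j => by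
    rw [hy j j.2.le, hk j j.2, hκ]
  obtain ⟨-, h4, h5⟩ := hret.type_eq hpT hT hr kk hkk
  have hcy : clsAt y p = c := h4.symm.trans hcl
  rw [hcl] at h5
  refine ⟨(y, p), ⟨⟨modType_eq_cycle hc hret.triv hT hr hcy, ?_⟩, hcy⟩, ?_⟩
  · dsimp only
    rw [mul_inv_cancel_right]
    exact add_right_cancel ((modType_add_eq hc h5).trans htype.symm)
  · refine Prod.ext rfl (funext fun j => PNat.eq ?_)
    change cycleLen (x * y * y⁻¹).right (y.right ((y.right ^ (j : ℕ)) p)) = kk j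
    rw [mul_inv_cancel_right, (hret.cycle_of_return (hret.pow_mem hpT j)).1, hkk]

theorem ncard_pointedFactors [Finite Γ] (hc : c ≠ 1) {z : Wreath Γ n} {lam : PartnFun Γ}
    (hdeg : (modType z).deg = lam.deg + r) :
    (pointedFactors z lam r c).ncard = (returnData z lam r c).ncard := by
  have h : Set.BijOn (returnTimes z r) (pointedFactors z lam r c) (returnData z lam r c) :=
    ⟨returnTimes_mapsTo hc hdeg, returnTimes_injOn hc hdeg, returnTimes_surjOn hc z lam⟩
  rw [← h.image_eq, h.injOn.ncard_image]

theorem ncard_pointedFactors_eq_mul [Finite Γ] (hc : c ≠ 1) (z : Wreath Γ n) (lam : PartnFun Γ) :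
    (pointedFactors z lam r c).ncard = r * (factors z lam r c).ncard := by
  classical
  have hF := Set.toFinite (factors z lam r c)
  have h : pointedFactors z lam r c =
      ((hF.toFinset.sigma fun y => clsSet y c).map (Equiv.sigmaEquivProd _ _).toEmbedding :
        Finset (Wreath Γ n × Fin n)) := by
    ext ⟨y, p⟩
    simp [pointedFactors, mem_clsSet]
  rw [h, Set.ncard_coe_finset, Finset.card_map, Finset.card_sigma,
    Finset.sum_congr rfl (g := fun _ => (r : ℕ)), Finset.sum_const, smul_eq_mul, mul_comm,
    Set.ncard_eq_toFinset_card _ hF]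
  intro y hy
  rw [card_clsSet_of_modType hc ((hF.mem_toFinset.1 hy).1)]

end Bijection

section Coefficient

variable {Γ : Type*} [Group Γ] [Finite Γ] {n : ℕ}

theorem coeff_classSum_mul (lam mu : PartnFun Γ) (z : Wreath Γ n) :
    (classSum n lam * classSum n mu).coeff z =
      ({y | modType y = mu ∧ modType (z * y⁻¹) = lam} : Set (Wreath Γ n)).ncard := by
  classical
  unfold classSum
  rw [Finset.sum_mul_sum, Finset.sum_comm, MonoidAlgebra.coeff_sum, Finsupp.finsetSum_apply,
    Set.ncard_eq_toFinset_card _ (Set.toFinite _)]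
  have h : (Set.toFinite {y : Wreath Γ n | modType y = mu ∧ modType (z * y⁻¹) = lam}).toFinset =
      (Set.toFinite {y : Wreath Γ n | modType y = mu}).toFinset.filter
        (fun y => modType (z * y⁻¹) = lam) := by
    ext y
    simp
  rw [h, Finset.card_filter, Nat.cast_sum]
  refine Finset.sum_congr rfl fun y _ => ?_
  rw [MonoidAlgebra.coeff_sum, Finsupp.finsetSum_apply]
  simp only [MonoidAlgebra.single_mul_single, MonoidAlgebra.coeff_single, mul_one,
    Finsupp.single_apply, ← eq_mul_inv_iff_mul_eq]
  rw [Finset.sum_ite_eq']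
  simp

end Coefficient

section Sequences

theorem exists_partOf_eq {m : ℕ} (W : Partn) (h : Multiset.card W = m) :
    ∃ kk : Fin m → ℕ+, partOf kk = W := by
  subst h
  induction W using Quotient.inductionOn with
  | _ l =>
  refine ⟨l.get, ?_⟩
  change (Finset.univ : Finset (Fin l.length)).val.map l.get = l
  rw [Fin.univ_val_map, List.ofFn_get]

theorem card_partOf {m : ℕ} (kk : Fin m → ℕ+) : Multiset.card (partOf kk) = m := by
  simp [partOf]

theorem size_partOf {m : ℕ} (kk : Fin m → ℕ+) : (partOf kk).size = ∑ j, (kk j : ℕ) := by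
  rw [partOf, Partn.size, Multiset.map_map]
  rfl

theorem count_partOf {m : ℕ} (kk : Fin m → ℕ+) (a : ℕ+) :
    (partOf kk).count a = Fintype.card {j // kk j = a} := by
  rw [partOf, Multiset.count_map, Fintype.card_subtype, ← Finset.filter_val, Finset.card_val]
  simp only [eq_comm]

theorem partOf_eq_iff {m : ℕ} (kk ll : Fin m → ℕ+) :
    partOf kk = partOf ll ↔ ∃ g : Equiv.Perm (Fin m), ll ∘ g = kk := by
  constructor
  · intro h
    have hc : ∀ a, Fintype.card {j // kk j = a} = Fintype.card {j // ll j = a} := fun a => by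
      rw [← count_partOf, ← count_partOf, h]
    refine ⟨Equiv.ofFiberEquiv fun a => Fintype.equivOfCardEq (hc a), ?_⟩
    funext j
    exact Equiv.ofFiberEquiv_map _ _
  · rintro ⟨g, rfl⟩
    rw [partOf, partOf, ← Multiset.map_map, Multiset.map_univ_val_equiv]

theorem ncard_partOf_eq {m : ℕ} (W : Partn) (h : Multiset.card W = m) :
    {kk : Fin m → ℕ+ | partOf kk = W}.ncard * ∏ a ∈ W.toFinset, (W.count a)! = m ! := by
  classical
  obtain ⟨f, rfl⟩ := exists_partOf_eq W h
  have hS : {kk : Fin m → ℕ+ | partOf kk = partOf f} =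
      ((Finset.univ : Finset (Equiv.Perm (Fin m))).image
        fun g : Equiv.Perm (Fin m) => f ∘ g : Finset (Fin m → ℕ+)) := by
    ext kk
    simp [partOf_eq_iff]
  have hstab := DomMulAct.stabilizer_card' f
  have himg : Finset.univ.image f = (partOf f).toFinset := rfl
  simp only [himg, ← count_partOf] at hstab
  rw [← hstab, hS, Set.ncard_coe_finset]
  have h1 := Finset.card_eq_sum_card_fiberwise (f := fun g : Equiv.Perm (Fin m) => f ∘ g)
    (s := Finset.univ) (t := Finset.univ.image fun g : Equiv.Perm (Fin m) => f ∘ g)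
    (fun g hg => Finset.mem_coe.2 (Finset.mem_image_of_mem _ hg))
  rw [Finset.card_univ, Fintype.card_perm, Fintype.card_fin] at h1
  rw [h1, Finset.sum_congr rfl (g := fun _ => Fintype.card {g : Equiv.Perm (Fin m) // f ∘ g = f}),
    Finset.sum_const, smul_eq_mul]
  intro kk hkk
  obtain ⟨g₀, -, rfl⟩ := Finset.mem_image.1 hkk
  rw [← Fintype.card_subtype]
  refine Fintype.card_congr (Equiv.subtypeEquiv (Equiv.mulRight g₀⁻¹) fun g => ?_)
  constructor
  · intro hg
    funext j
    have := congrFun hg (g₀⁻¹ j)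
    simpa using this
  · intro hg
    funext j
    have := congrFun hg (g₀ j)
    simpa using this

theorem Partn.eq_of_pred (W : Partn) :
    W = W.pred.map (fun a => a + 1) +
      Multiset.replicate (Multiset.card W - Multiset.card W.pred) 1 := by
  induction W using Multiset.induction_on with
  | empty => rfl
  | cons a W ih =>
    rw [pred_cons]
    split_ifs with h
    · rw [Multiset.map_add, Multiset.map_singleton, PNat.sub_add_of_lt h, Multiset.card_add,
        Multiset.card_singleton, Multiset.card_cons, add_comm 1, Nat.add_sub_add_right, add_assoc,
        ← ih, Multiset.singleton_add]
    · have ha : a = 1 := le_antisymm (not_lt.1 h) one_le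
      rw [zero_add, Multiset.card_cons, Nat.sub_add_comm (card_pred_le W),
        Multiset.replicate_succ, Multiset.add_cons, ← ih, ha]

theorem Partn.pred_map_add (μ : Partn) (m : ℕ) :
    Partn.pred (μ.map (fun a => a + 1) + Multiset.replicate m 1) = μ := by
  rw [pred_add, (pred_eq_zero_iff _).2 (fun a ha => Multiset.eq_of_mem_replicate ha), add_zero]
  induction μ using Multiset.induction_on with
  | empty => rfl
  | cons a W ih =>
    rw [Multiset.map_cons, pred_cons, ih, if_pos (PNat.lt_add_left 1 a), Multiset.singleton_add,
      PNat.add_sub]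

theorem ncard_pred_partOf (r : ℕ+) (μ : Partn) (h : Multiset.card μ ≤ r) :
    {kk : Fin r → ℕ+ | (partOf kk).pred = μ}.ncard * coeffDen r μ = (r : ℕ)! := by
  classical
  set W : Partn := μ.map (fun a => a + 1) + Multiset.replicate (r - Multiset.card μ) 1 with hW
  have hcard : Multiset.card W = r := by
    simp [hW]
    omega
  have hset : {kk : Fin r → ℕ+ | (partOf kk).pred = μ} = {kk | partOf kk = W} := by
    ext kk
    simp only [Set.mem_ofPred_eq]
    constructor
    · intro hk
      have := Partn.eq_of_pred (partOf kk)
      rwa [hk, card_partOf] at this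
    · intro hk
      rw [hk, hW, Partn.pred_map_add]
  have hone : ∀ a : ℕ+, a + 1 ≠ 1 := fun a => (PNat.lt_add_left 1 a).ne'
  have hprod : ∏ a ∈ W.toFinset, (W.count a)! = coeffDen r μ := by
    have hsub : W.toFinset ⊆ insert 1 (μ.toFinset.image fun a => a + 1) := by
      intro a ha
      rw [Multiset.mem_toFinset, hW, Multiset.mem_add, Multiset.mem_map] at ha
      rcases ha with ⟨b, hb, rfl⟩ | ha
      · exact Finset.mem_insert_of_mem (Finset.mem_image_of_mem _ (Multiset.mem_toFinset.2 hb))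
      · rw [Multiset.eq_of_mem_replicate ha]
        exact Finset.mem_insert_self _ _
    rw [Finset.prod_subset hsub, Finset.prod_insert, Finset.prod_image, coeffDen]
    · congr 1
      · rw [hW, Multiset.count_add, Multiset.count_replicate_self, Multiset.count_eq_zero_of_notMem,
          zero_add]
        simp [hone]
      · refine Finset.prod_congr rfl fun a _ => ?_
        rw [hW, Multiset.count_add, Multiset.count_map_eq_count' _ _ (add_left_injective 1),
          Multiset.count_eq_zero_of_notMem
            (fun ha => hone a (Multiset.eq_of_mem_replicate ha)), add_zero]
    · exact fun a _ b _ hab => add_left_injective 1 hab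
    · simp [hone]
    · intro a _ ha
      rw [Multiset.count_eq_zero_of_notMem (fun h => ha (Multiset.mem_toFinset.2 h)),
        Nat.factorial_zero]
  rw [hset, ← hprod, ncard_partOf_eq W hcard]

end Sequences

section StructureConstants

variable {Γ : Type*} [Group Γ] {n : ℕ} {r : ℕ+} {c : ConjClasses Γ}

theorem eq_of_mem_returnData {z : Wreath Γ n} {lam : PartnFun Γ} {b : Fin n × (Fin r → ℕ+)}
    (hb : b ∈ returnData z lam r c) :
    modType z + PartnFun.at 1 (partOf b.2).pred =
        lam + PartnFun.cycle (addSize (partOf b.2).pred r) c ∧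
      pLen z b.1 = addSize (partOf b.2).pred r := by
  obtain ⟨-, h2, h3⟩ := hb
  have hL : pLen z b.1 = addSize (partOf b.2).pred r := by
    refine PNat.eq ?_
    have := Partn.size_pred_add_card (partOf b.2)
    rw [card_partOf, size_partOf, h2] at this
    exact this.symm
  rw [← h3, hL]
  exact ⟨rfl, rfl⟩

theorem returnData_eq (hc : c ≠ 1) {z : Wreath Γ n} {lam : PartnFun Γ} {μ : Partn}
    (hν : modType z + PartnFun.at 1 μ = lam + PartnFun.cycle (addSize μ r) c) :
    returnData z lam r c =
      {p : Fin n | clsAt z p = c ∧ cycleLen z.right p = addSize μ r} ×ˢ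
        {kk : Fin r → ℕ+ | (partOf kk).pred = μ} := by
  ext ⟨p, kk⟩
  simp only [Set.mem_prod, Set.mem_ofPred_eq]
  constructor
  · intro h
    obtain ⟨h1, h2⟩ := eq_of_mem_returnData h
    dsimp only at h1 h2
    have h3 := congrFun h1 1
    have h4 := congrFun hν 1
    rw [Pi.add_apply, Pi.add_apply, PartnFun.cycle, PartnFun.at_same, PartnFun.at_ne hc.symm]
      at h3 h4
    have h5 : (partOf kk).pred = μ := add_left_cancel (h3.trans h4.symm)
    rw [h5] at h2
    exact ⟨⟨h.1, congrArg PNat.val h2⟩, h5⟩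
  · rintro ⟨⟨h1, h2⟩, h3⟩
    refine ⟨h1, ?_, ?_⟩
    · have := Partn.size_pred_add_card (partOf kk)
      rw [card_partOf, size_partOf, h3] at this
      rw [← this]
      exact h2.symm
    · dsimp only
      rw [h3, hν, show pLen z p = addSize μ r from PNat.eq h2]
      rfl

variable [Finite Γ]

theorem ncard_factors_mul (hc : c ≠ 1) {z : Wreath Γ n} {lam : PartnFun Γ} {μ : Partn}
    (hν : modType z + PartnFun.at 1 μ = lam + PartnFun.cycle (addSize μ r) c)
    (hcard : Multiset.card μ ≤ r) (hdeg : (modType z).deg = lam.deg + r) :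
    (factors z lam r c).ncard * coeffDen r μ = coeffNum lam r c μ := by
  classical
  have h1 := ncard_pointedFactors hc hdeg
  rw [ncard_pointedFactors_eq_mul hc, returnData_eq hc hν, Set.ncard_prod] at h1
  have h2 : {p : Fin n | clsAt z p = c ∧ cycleLen z.right p = addSize μ r}.ncard =
      addSize μ r * ((lam c).count (addSize μ r) + 1) := by
    have h := card_points z c (addSize μ r)
    have h3 := congrFun hν c
    rw [Pi.add_apply, Pi.add_apply, PartnFun.cycle, PartnFun.at_same, PartnFun.at_ne hc,
      add_zero, modType_of_ne z hc] at h3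
    rw [h3, Multiset.count_add, Multiset.count_singleton_self] at h
    rw [← h, ← Set.ncard_coe_finset]
    congr 1
    ext p
    simp
  have h3 := ncard_pred_partOf r μ hcard
  have h4 : (r : ℕ)! = r * ((r : ℕ) - 1)! := (Nat.mul_factorial_pred r.pos.ne').symm
  refine Nat.eq_of_mul_eq_mul_left r.pos ?_
  rw [← mul_assoc, h1, mul_assoc, h3, h2, h4, coeffNum]
  change (μ.size + r) * _ * _ = _
  ring

theorem exists_of_factors_nonempty (hc : c ≠ 1) {z : Wreath Γ n} {lam : PartnFun Γ}
    (hdeg : (modType z).deg = lam.deg + r) (h : (factors z lam r c).Nonempty) :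
    ∃ μ : Partn, μ ≤ lam 1 ∧ Multiset.card μ ≤ r ∧
      modType z + PartnFun.at 1 μ = lam + PartnFun.cycle (addSize μ r) c := by
  obtain ⟨y, hy⟩ := h
  have hpos : 0 < (clsSet y c).card := by
    rw [card_clsSet_of_modType hc hy.1]
    exact r.pos
  obtain ⟨p, hp⟩ := Finset.card_pos.1 hpos
  have hb := returnTimes_mapsTo hc hdeg (show (y, p) ∈ pointedFactors z lam r c from
    ⟨hy, mem_clsSet.1 hp⟩)
  obtain ⟨h1, -⟩ := eq_of_mem_returnData hb
  refine ⟨_, ?_, ?_, h1⟩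
  · have h2 := congrFun h1 1
    rw [Pi.add_apply, Pi.add_apply, PartnFun.cycle, PartnFun.at_same, PartnFun.at_ne hc.symm,
      add_zero] at h2
    rw [← h2]
    exact Multiset.le_add_left _ _
  · exact (Partn.card_pred_le _).trans (card_partOf _).le

end StructureConstants

section Existence

theorem finRotate_mod (L : ℕ) (hL : 0 < L) (m : ℕ) :
    finRotate L ⟨m % L, Nat.mod_lt _ hL⟩ = ⟨(m + 1) % L, Nat.mod_lt _ hL⟩ := by
  obtain ⟨k, rfl⟩ := Nat.exists_eq_succ_of_ne_zero hL.ne'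
  rw [finRotate_apply]
  refine Fin.ext ?_
  rw [Fin.val_add]
  simp [Nat.add_mod]

variable {Γ : Type*} [Group Γ] [Finite Γ]

theorem exists_wreathType_eq (τ : PartnFun Γ) :
    ∃ (n : ℕ) (z : Wreath Γ n), wreathType z = τ := by
  classical
  have := Fintype.ofFinite (ConjClasses Γ)
  choose kk hkk using fun d => exists_partOf_eq (τ d) rfl
  let len : (Σ d, Fin (Multiset.card (τ d))) → ℕ+ := fun q => kk q.1 q.2
  let P : Type _ := Σ q : (Σ d, Fin (Multiset.card (τ d))), Fin (len q)
  let e : P ≃ Fin (Fintype.card P) := Fintype.equivFin P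
  let σ : Equiv.Perm P := Equiv.sigmaCongrRight fun q => finRotate (len q)
  let z : Wreath Γ (Fintype.card P) := ofLab (e.permCongr σ)
    (fun i => if ((e.symm i).2 : ℕ) = 0 then Quotient.out (e.symm i).1.1 else 1)
  let pt : (Σ d, Fin (Multiset.card (τ d))) → ℕ → Fin (Fintype.card P) := fun q m =>
    e ⟨q, ⟨m % len q, Nat.mod_lt _ (len q).pos⟩⟩
  have hpt : ∀ q m, z.right (pt q m) = pt q (m + 1) := by
    intro q m
    change e (σ (e.symm (e _))) = _
    rw [e.symm_apply_apply]
    change e ⟨q, finRotate (len q) _⟩ = _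
    rw [finRotate_mod _ (len q).pos]
  have hlab : ∀ q m, lab z (pt q m) = if m % len q = 0 then Quotient.out q.1 else 1 := by
    intro q m
    rw [lab_ofLab, e.symm_apply_apply]
  have hpow : ∀ q m, (z.right ^ m) (pt q 0) = pt q m := by
    intro q m
    induction m with
    | zero => rfl
    | succ m ih => rw [pow_succ', Equiv.Perm.mul_apply, ih, hpt]
  have hptinj : ∀ q (m : ℕ), m < len q → pt q m = pt q 0 → m = 0 := by
    intro q m hm h
    have h1 := eq_of_heq (Sigma.mk.inj (e.injective h)).2
    have h2 := congrArg Fin.val h1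
    simpa [Nat.mod_eq_of_lt hm] using h2
  have hlen0 : ∀ q, cycleLen z.right (pt q 0) = len q := by
    intro q
    refine cycleLen_eq_of (len q).pos ?_ ?_
    · rw [hpow]
      simp [pt]
    · intro m hm hlt h
      rw [hpow] at h
      exact hm.ne' (hptinj q m hlt h)
  have hlabpow : ∀ q (m : ℕ), m < len q → lab (z ^ (m + 1)) (pt q 0) = Quotient.out q.1 := by
    intro q m hm
    induction m with
    | zero => rw [zero_add, pow_one, hlab, Nat.zero_mod, if_pos rfl]
    | succ m ih =>
      rw [pow_succ', lab_mul, right_pow, hpow, ih (by omega), hlab, Nat.mod_eq_of_lt hm,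
        if_neg (Nat.succ_ne_zero m), one_mul]
  have hcls0 : ∀ q, clsAt z (pt q 0) = q.1 := by
    intro q
    have h := hlabpow q ((len q : ℕ) - 1) (Nat.sub_lt (len q).pos one_pos)
    rw [Nat.sub_add_cancel (Nat.one_le_iff_ne_zero.2 (len q).pos.ne')] at h
    rw [clsAt, cycleProd_eq_lab, hlen0, h]
    exact Quotient.out_eq q.1
  have hsame : ∀ a : P, z.right.SameCycle (pt a.1 0) (e a) := by
    rintro ⟨q, j⟩
    have : e ⟨q, j⟩ = pt q j := by simp [pt, Nat.mod_eq_of_lt j.2]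
    rw [this, ← hpow q j]
    exact sameCycle_pow _ _ _
  refine ⟨_, z, ?_⟩
  funext d
  ext a
  refine Nat.eq_of_mul_eq_mul_left a.pos ?_
  rw [← card_points, Finset.card_filter, ← e.sum_comp, Fintype.sum_sigma]
  simp only [← cycleLen_congr (hsame _), ← clsAt_congr (hsame _), hlen0, hcls0]
  rw [Fintype.sum_sigma, Finset.sum_eq_single d]
  · have hcount := count_partOf (kk d) a
    rw [hkk d] at hcount
    rw [hcount, Fintype.card_subtype, Finset.card_filter, Finset.mul_sum]
    refine Finset.sum_congr rfl fun j _ => ?_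
    rw [Finset.sum_const, Finset.card_univ, Fintype.card_fin, smul_eq_mul]
    by_cases h : kk d j = a
    · simp [len, h]
    · have h' : (kk d j : ℕ) ≠ a := fun h' => h (PNat.eq h')
      simp [len, h, h']
  · intro d' _ hd
    simp [hd]
  · simp

theorem exists_modType_eq (ρ : PartnFun Γ) : ∃ (n : ℕ) (z : Wreath Γ n), modType z = ρ := by
  classical
  obtain ⟨n, z, hz⟩ := exists_wreathType_eq
    (fun d => if d = 1 then (ρ d).map (fun a => a + 1) else ρ d)
  refine ⟨n, z, ?_⟩
  funext d
  by_cases hd : d = 1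
  · subst hd
    rw [modType_one, hz]
    simpa using Partn.pred_map_add (ρ 1) 0
  · rw [modType_of_ne z hd, hz]
    exact if_neg hd

end Existence

section Final

variable {Γ : Type*} [Group Γ] {r : ℕ+} {c : ConjClasses Γ}

theorem sub_at_add (c : ConjClasses Γ) {lam : PartnFun Γ} {μ : Partn} (h : μ ≤ lam 1) :
    lam + PartnFun.cycle (addSize μ r) c - PartnFun.at 1 μ + PartnFun.at 1 μ =
      lam + PartnFun.cycle (addSize μ r) c := by
  refine tsub_add_cancel_of_le fun d => ?_
  rcases eq_or_ne d 1 with rfl | hd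
  · rw [PartnFun.at_same]
    exact h.trans (Multiset.le_add_right _ _)
  · rw [PartnFun.at_ne hd]
    exact Multiset.zero_le _

variable [Finite Γ]

theorem structConst_eq {lam mu ν : PartnFun Γ} {a : ℤ} (h : IsStructConst lam mu ν a) :
    structConst lam mu ν = a := by
  obtain ⟨n, z, hz⟩ := exists_modType_eq ν
  have hex : ∃ a, IsStructConst lam mu ν a := ⟨a, h⟩
  rw [structConst, dif_pos hex, ← h n z hz]
  exact (hex.choose_spec n z hz).symm

theorem deg_of_add_eq {lam ν : PartnFun Γ} {μ : Partn}
    (hν : ν + PartnFun.at 1 μ = lam + PartnFun.cycle (addSize μ r) c) :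
    ν.deg = lam.deg + r := by
  have h := congrArg PartnFun.deg hν
  rw [PartnFun.deg_add, PartnFun.deg_add, PartnFun.deg_at, PartnFun.deg_cycle] at h
  change _ = _ + (μ.size + r) at h
  omega

theorem coeffDen_dvd (hc : c ≠ 1) {lam ν : PartnFun Γ} {μ : Partn}
    (hν : ν + PartnFun.at 1 μ = lam + PartnFun.cycle (addSize μ r) c)
    (hcard : Multiset.card μ ≤ r) : coeffDen r μ ∣ coeffNum lam r c μ := by
  obtain ⟨n, z, rfl⟩ := exists_modType_eq ν
  exact Dvd.intro_left _ (ncard_factors_mul hc hν hcard (deg_of_add_eq hν))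

theorem coeffDen_pos (r : ℕ+) (μ : Partn) : 0 < coeffDen r μ :=
  Nat.mul_pos (Nat.factorial_pos _) (Finset.prod_pos fun _ _ => Nat.factorial_pos _)

theorem isStructConst_of_add_eq (hc : c ≠ 1) {lam ν : PartnFun Γ} {μ : Partn}
    (hν : ν + PartnFun.at 1 μ = lam + PartnFun.cycle (addSize μ r) c)
    (hcard : Multiset.card μ ≤ r) :
    IsStructConst lam (PartnFun.cycle r c) ν ((coeffNum lam r c μ / coeffDen r μ : ℕ) : ℤ) := by
  rintro n z rfl
  rw [coeff_classSum_mul]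
  have h := ncard_factors_mul hc hν hcard (deg_of_add_eq hν)
  rw [← h, Nat.mul_div_cancel _ (coeffDen_pos r μ)]
  rfl

theorem isStructConst_zero (hc : c ≠ 1) {lam ν : PartnFun Γ} (hdeg : ν.deg = lam.deg + r)
    (h : ¬ ∃ μ : Partn, μ ≤ lam 1 ∧ Multiset.card μ ≤ r ∧
      ν + PartnFun.at 1 μ = lam + PartnFun.cycle (addSize μ r) c) :
    IsStructConst lam (PartnFun.cycle r c) ν 0 := by
  rintro n z rfl
  rw [coeff_classSum_mul]
  change ((factors z lam r c).ncard : ℤ) = 0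
  by_contra hne
  refine h (exists_of_factors_nonempty hc hdeg ?_)
  rw [Set.nonempty_iff_ne_empty]
  intro h0
  rw [h0, Set.ncard_empty] at hne
  exact hne rfl

theorem exists_isStructConst (hc : c ≠ 1) {lam ν : PartnFun Γ} (hdeg : ν.deg = lam.deg + r) :
    ∃ a, IsStructConst lam (PartnFun.cycle r c) ν a := by
  by_cases h : ∃ μ : Partn, μ ≤ lam 1 ∧ Multiset.card μ ≤ r ∧
      ν + PartnFun.at 1 μ = lam + PartnFun.cycle (addSize μ r) c
  · obtain ⟨μ, -, h2, h3⟩ := h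
    exact ⟨_, isStructConst_of_add_eq hc h3 h2⟩
  · exact ⟨_, isStructConst_zero hc hdeg h⟩

end Final

end FarahatHigman

open FarahatHigman in
theorem mainTheorem3 {Γ : Type*} [Group Γ] [Finite Γ] (lam : PartnFun Γ) (r : ℕ+)
    (c : ConjClasses Γ) (hc : c ≠ 1) :
    -- the structure constants entering the product are well defined
    (∀ ν : PartnFun Γ, ν.deg = lam.deg + (PartnFun.cycle r c).deg →
      IsStructConst lam (PartnFun.cycle r c) ν (structConst lam (PartnFun.cycle r c) ν)) ∧
    -- the coefficients in the formula are integers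
    (∀ μ : Partn, μ ≤ lam 1 → Multiset.card μ ≤ r → coeffDen r μ ∣ coeffNum lam r c μ) ∧
    K lam * K (PartnFun.cycle r c) =
      ∑ μ ∈ (Finset.Iic (lam 1)).filter (fun μ => Multiset.card μ ≤ r),
        (coeffNum lam r c μ / coeffDen r μ) •
          K (lam + PartnFun.cycle (addSize μ r) c - PartnFun.at 1 μ) := by
  classical
  refine ⟨fun ν hν => ?_, fun μ h1 h2 => coeffDen_dvd hc (sub_at_add c h1) h2, ?_⟩
  · rw [PartnFun.deg_cycle] at hν
    obtain ⟨a, ha⟩ := exists_isStructConst hc hν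
    rwa [structConst_eq ha]
  · let f : Partn → PartnFun Γ := fun μ =>
      lam + PartnFun.cycle (addSize μ r) c - PartnFun.at 1 μ
    have hf : ∀ μ ≤ lam 1, f μ + PartnFun.at 1 μ = lam + PartnFun.cycle (addSize μ r) c :=
      fun μ h => sub_at_add c h
    rw [K_mul_K, basisMul]
    have himg : ∑ ν ∈ ((Finset.Iic (lam 1)).filter (fun μ => Multiset.card μ ≤ r)).image f,
        structConst lam (PartnFun.cycle r c) ν • K ν =
        ∑ μ ∈ (Finset.Iic (lam 1)).filter (fun μ => Multiset.card μ ≤ r),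
          (coeffNum lam r c μ / coeffDen r μ) • K (f μ) := by
      rw [Finset.sum_image]
      · refine Finset.sum_congr rfl fun μ hμ => ?_
        rw [Finset.mem_filter, Finset.mem_Iic] at hμ
        rw [structConst_eq (isStructConst_of_add_eq hc (hf μ hμ.1) hμ.2), natCast_zsmul]
      · intro μ hμ μ' hμ' h
        rw [Finset.mem_coe, Finset.mem_filter, Finset.mem_Iic] at hμ hμ'
        have h1 := congrFun (hf μ hμ.1) 1
        have h2 := congrFun (hf μ' hμ'.1) 1
        rw [Pi.add_apply, Pi.add_apply, PartnFun.cycle, PartnFun.at_same, PartnFun.at_ne hc.symm]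
          at h1 h2
        rw [← h] at h2
        exact add_left_cancel (h1.trans h2.symm)
    refine Eq.trans ?_ himg
    symm
    refine Finset.sum_subset ?_ ?_
    · intro ν hν
      obtain ⟨μ, hμ, rfl⟩ := Finset.mem_image.1 hν
      rw [Finset.mem_filter, Finset.mem_Iic] at hμ
      rw [Set.Finite.mem_toFinset, Set.mem_ofPred_eq, PartnFun.deg_cycle]
      exact deg_of_add_eq (hf μ hμ.1)
    · intro ν hν hν'
      rw [Set.Finite.mem_toFinset, Set.mem_ofPred_eq, PartnFun.deg_cycle] at hν
      rw [structConst_eq (isStructConst_zero hc hν ?_), zero_smul]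
      rintro ⟨μ, h1, h2, h3⟩
      refine hν' (Finset.mem_image.2 ⟨μ, Finset.mem_filter.2 ⟨Finset.mem_Iic.2 h1, h2⟩, ?_⟩)
      exact add_right_cancel ((hf μ h1).trans h3.symm)
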